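/- Let $n\neq 1$ be a non-negative integer, and let $\mathcal{BT}_n$ be the arrangement in $\mathbb{R}^n$ of the hyperplanes $x_i+x_j=0$ ($1\le i<j\le n$) and $x_i=\pm\frac12$ ($1\le i\le n$). Its regions are the connected components of the complement of the union of the hyperplanes. Put $N=\{-n,\dots,n\}\setminus\{0\}$ and $x_{-i}=-x_i$. **Order associated to a region.** For a region $R$, define a relation $\prec_R$ on $N\cup\{-\frac12,\frac12\}$ as follows. For $i\ne j$ in $\{1,\dots,n\}$, $i\prec_R -j$ if $x_i+x_j<0$ on $R$, and $-j\prec_R i$ if $x_i+x_j>0$ on $R$. For $a\in N$ and $\varepsilon\in\{-\frac12,\frac12\}$, $a\prec_R\varepsilon$ if $x_a<\varepsilon$ on $R$, and $\varepsilon\prec_R a$ if $x_a>\varepsilon$ on $R$. No other pairs are related. For $a,b\in N$ write $a\sim b$ if $a,b$ have the same sign and there is no $c\in N\cup\{-\frac12,\frac12\}$ with $a\prec_R c\prec_R b$ or $b\prec_R c\prec_R a$. The classes of $\sim$ are called the blocks of $R$. Define a relation $<$ on the set of the blocks of $R$ together with $\pm\frac12$ as follows: - for blocks $B,B'$: $B<B'$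 if there are $m\ge1$ and $c_0\prec_R c_1\prec_R\cdots\prec_R c_m$ in $N\cup\{-\frac12,\frac12\}$ with $c_0\in B$ and $c_m\in B'$; - $-\frac12<\frac12$; - for a block $B$ and $\varepsilon=\pm\frac12$: $B<\varepsilon$ (respectively $\varepsilon<B$) if $b\prec_R\varepsilon$ (respectively $\varepsilon\prec_R b$) for some $b\in B$; - if there is a unique $i\in\{1,\dots,n\}$ with $-\frac12\prec_R i\prec_R\frac12$, then moreover $\{-i\}<\{i\}$ if the first block after $\frac12$ consists of positive numbers, and $\{i\}<\{-i\}$ if it consists of negative numbers. **Claim.** For every region $R$ of $\mathcal{BT}_n$, the relation $<$ is a (strict) total order on the set of the blocks of $R$ together with $\pm\frac12$, and it has one of the following forms. In each form $B_1,\dots,B_k,-B_1,\dots,-B_k$ are non-empty pairwise disjoint sets with union $N$, all elements of each $B_i$ have the same sign (called the sign of $B_i$), and $-B=\{-b: b\in B\}$. 1. $-B_k<\cdots<-B_2<-B_1<-\frac12<\frac12<B_1<B_2<\cdots<B_k$, where $B_i$ and $B_{i+1}$ have opposite signs for all $1\le i\le k-1$. 2. $-B_k<\cdots<-B_{l+1}<-\frac12<-B_l<\cdots<-B_1<B_1<\cdots<B_l<\frac12<B_{l+1}<\cdots<B_k$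 for some $1\le l\le k$, where $|B_1|>1$, and $B_i$ and $B_{i+1}$ have opposite signs for all $1\le i\le l-1$ and all $l+1\le i\le k-1$. 3. $-B_k<\cdots<-B_2<-\frac12<-B_1<B_1<\frac12<B_2<\cdots<B_k$ with $k\ge2$, where $|B_1|=1$, $B_1$ and $B_2$ have the same sign, and $B_i$ and $B_{i+1}$ have opposite signs for all $2\le i\le k-1$. Moreover, the map sending a region to this order is a bijection from the set of regions of $\mathcal{BT}_n$ onto the set of all total orders of the forms 1, 2 and 3. -/

import Mathlib

namespace BoxedThreshold

/-! ### The arrangement and its regions -/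

/-- The boxed threshold arrangement in `ℝⁿ`: the hyperplanes `x_i + x_j = 0` for `i < j`, and
`x_i = -1/2`, `x_i = 1/2` for all `i`. -/
def arrangement (n : ℕ) : Set (Set (Fin n → ℝ)) :=
  {H | (∃ i j : Fin n, i < j ∧ H = {x | x i + x j = 0}) ∨
       (∃ i : Fin n, H = {x | x i = -(1 / 2)}) ∨
       (∃ i : Fin n, H = {x | x i = 1 / 2})}

/-- The regions of an arrangement: the connected components of the complement of the union of
its hyperplanes. -/
def regions {n : ℕ} (𝒜 : Set (Set (Fin n → ℝ))) : Set (Set (Fin n → ℝ)) :=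
  {R | ∃ x ∈ (⋃₀ 𝒜)ᶜ, R = connectedComponentIn (⋃₀ 𝒜)ᶜ x}

/-! ### Signed elements -/

/-- The set `N = {-n, …, n} \ {0}`: the index `i : Fin n` stands for the `(i + 1)`-st element of
`{1, …, n}`, so `pos i` is the integer `i + 1` and `neg i` is the integer `-(i + 1)`. -/
inductive Elt (n : ℕ) : Type
  | pos (i : Fin n) : Elt n
  | neg (i : Fin n) : Elt n

/-- The negative `-a` of a signed element. -/
instance (n : ℕ) : Neg (Elt n) where
  neg a := match a with
    | .pos i => .neg i
    | .neg i => .pos i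

/-- `a > 0`. -/
def Elt.IsPos {n : ℕ} : Elt n → Prop
  | .pos _ => True
  | .neg _ => False

/-- The coordinate `x_a` for `a ∈ N`, where `x_{-i} = -x_i`. -/
def Elt.coord {n : ℕ} (x : Fin n → ℝ) : Elt n → ℝ
  | .pos i => x i
  | .neg i => -x i

/-- The set `N ∪ {-1/2, 1/2}`. -/
inductive Pt (n : ℕ) : Type
  | elt (a : Elt n) : Pt n
  | negHalf : Pt n
  | half : Pt n

/-- The relation `a ≺_R b` on `N ∪ {-1/2, 1/2}`. Comparable are only elements of `N` with
different signs and different absolute values, and elements of `N` with `±1/2`. -/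
def Prec {n : ℕ} (R : Set (Fin n → ℝ)) : Pt n → Pt n → Prop
  | .elt (.pos i), .elt (.neg j) => i ≠ j ∧ ∀ x ∈ R, x i + x j < 0
  | .elt (.neg j), .elt (.pos i) => i ≠ j ∧ ∀ x ∈ R, 0 < x i + x j
  | .elt a, .half => ∀ x ∈ R, a.coord x < 1 / 2
  | .half, .elt a => ∀ x ∈ R, 1 / 2 < a.coord x
  | .elt a, .negHalf => ∀ x ∈ R, a.coord x < -(1 / 2)
  | .negHalf, .elt a => ∀ x ∈ R, -(1 / 2) < a.coord x
  | _, _ => False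

/-! ### Boxed threshold blocks -/

/-- The relation `a ∼ b` on `N`: same sign, and no `c` lies strictly between `a` and `b` with
respect to `≺_R`. -/
def Sim {n : ℕ} (R : Set (Fin n → ℝ)) (a b : Elt n) : Prop :=
  (a.IsPos ↔ b.IsPos) ∧
    ¬ ∃ c : Pt n, (Prec R (.elt a) c ∧ Prec R c (.elt b)) ∨
      (Prec R (.elt b) c ∧ Prec R c (.elt a))

/-- `B` is a boxed threshold block of `R`: a class of `∼`. -/
def IsBlock {n : ℕ} (R : Set (Fin n → ℝ)) (B : Set (Elt n)) : Prop :=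
  ∃ a : Elt n, B = {b | Sim R a b}

/-- The block `-B = {-b : b ∈ B}`. -/
def negBlock {n : ℕ} (B : Set (Elt n)) : Set (Elt n) :=
  (fun b => -b) '' B

/-- All elements of `B` are positive. -/
def IsPosBlock {n : ℕ} (B : Set (Elt n)) : Prop := ∀ b ∈ B, b.IsPos

/-- All elements of `B` are negative. -/
def IsNegBlock {n : ℕ} (B : Set (Elt n)) : Prop := ∀ b ∈ B, ¬ b.IsPos

/-- `B` and `B'` have opposite signs. -/
def OppSign {n : ℕ} (B B' : Set (Elt n)) : Prop :=
  (IsPosBlock B ∧ IsNegBlock B') ∨ (IsNegBlock B ∧ IsPosBlock B')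

/-- `B` and `B'` have the same sign. -/
def SameSign {n : ℕ} (B B' : Set (Elt n)) : Prop :=
  (IsPosBlock B ∧ IsPosBlock B') ∨ (IsNegBlock B ∧ IsNegBlock B')

/-! ### Orders on blocks together with `±1/2` -/

/-- A possible member of an ordered set of blocks and `±1/2`. -/
inductive Item (n : ℕ) : Type
  | block (B : Set (Elt n)) : Item n
  | negHalf : Item n
  | half : Item n

/-- A set of items together with a (strict) relation on items. -/
@[ext]
structure BlockOrder (n : ℕ) where
  /-- the ordered items -/
  carrier : Set (Item n)
  /-- the relation `<` -/
  lt : Item n → Item n → Prop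

/-- The relation is a strict total order on the carrier, and relates only its elements. -/
def BlockOrder.IsTotalOrder {n : ℕ} (O : BlockOrder n) : Prop :=
  (∀ a b, O.lt a b → a ∈ O.carrier ∧ b ∈ O.carrier) ∧
  (∀ a, ¬ O.lt a a) ∧
  (∀ a b c, O.lt a b → O.lt b c → O.lt a c) ∧
  (∀ a ∈ O.carrier, ∀ b ∈ O.carrier, O.lt a b ∨ a = b ∨ O.lt b a)

/-- The items ordered by a region: its boxed threshold blocks, `-1/2` and `1/2`. -/
def items {n : ℕ} (R : Set (Fin n → ℝ)) : Set (Item n) :=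
  {a | a = .negHalf ∨ a = .half ∨ ∃ B, IsBlock R B ∧ a = .block B}

/-- The order on blocks and `±1/2` before any convention: two blocks are compared through
chains (with at least one step) for `≺_R`, a block is compared with `±1/2` through one of its
elements, and `-1/2 < 1/2`. -/
def BaseLt {n : ℕ} (R : Set (Fin n → ℝ)) : Item n → Item n → Prop
  | .block B, .block B' => IsBlock R B ∧ IsBlock R B' ∧
      ∃ b ∈ B, ∃ b' ∈ B', Relation.TransGen (Prec R) (.elt b) (.elt b')
  | .block B, .half => IsBlock R B ∧ ∃ b ∈ B, Prec R (.elt b) .half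
  | .half, .block B => IsBlock R B ∧ ∃ b ∈ B, Prec R .half (.elt b)
  | .block B, .negHalf => IsBlock R B ∧ ∃ b ∈ B, Prec R (.elt b) .negHalf
  | .negHalf, .block B => IsBlock R B ∧ ∃ b ∈ B, Prec R .negHalf (.elt b)
  | .negHalf, .half => True
  | _, _ => False

/-- `-1/2 ≺_R i ≺_R 1/2`. -/
def IsMiddle {n : ℕ} (R : Set (Fin n → ℝ)) (i : Fin n) : Prop :=
  Prec R .negHalf (.elt (.pos i)) ∧ Prec R (.elt (.pos i)) .half

/-- `B` is the first block after `1/2`. -/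
def IsFirstAfterHalf {n : ℕ} (R : Set (Fin n → ℝ)) (B : Set (Elt n)) : Prop :=
  BaseLt R .half (.block B) ∧
    ∀ B', ¬ (BaseLt R .half (.block B') ∧ BaseLt R (.block B') (.block B))

/-- The convention for the case of a unique `i` with `-1/2 ≺_R i ≺_R 1/2`: if `B` is the first
block after `1/2`, then `{-i} < {i}` if `B` is positive, and `{i} < {-i}` if `B` is negative. -/
def ConvLt {n : ℕ} (R : Set (Fin n → ℝ)) (a a' : Item n) : Prop :=
  ∃ i : Fin n, IsMiddle R i ∧ (∀ j, IsMiddle R j → j = i) ∧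
    ∃ B, IsFirstAfterHalf R B ∧
      ((IsPosBlock B ∧ a = .block {Elt.neg i} ∧ a' = .block {Elt.pos i}) ∨
       (IsNegBlock B ∧ a = .block {Elt.pos i} ∧ a' = .block {Elt.neg i}))

/-- The order associated to a region: the order above, completed by the convention. -/
def regionOrder {n : ℕ} (R : Set (Fin n → ℝ)) : BlockOrder n where
  carrier := items R
  lt a b := BaseLt R a b ∨ ConvLt R a b

/-! ### The three forms -/

/-- The order `L₀ < L₁ < ⋯` displayed by a list. -/
def ofList {n : ℕ} (L : List (Item n)) : BlockOrder n where
  carrier := {a | a ∈ L}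
  lt a b := ∃ p q : Fin L.length, p < q ∧ L.get p = a ∧ L.get q = b

/-- The sequence
`-B_k, …, -B_{l+1}, -1/2, -B_l, …, -B_1, B_1, …, B_l, 1/2, B_{l+1}, …, B_k`,
where `C = [B_1, …, B_l]` and `D = [B_{l+1}, …, B_k]`. -/
def symList {n : ℕ} (C D : List (Set (Elt n))) : List (Item n) :=
  (D.map fun B => Item.block (negBlock B)).reverse ++ [Item.negHalf] ++
  (C.map fun B => Item.block (negBlock B)).reverse ++
  C.map Item.block ++ [Item.half] ++ D.map Item.block

/-- The sets `B_1, …, B_k, -B_1, …, -B_k` form a partition of `N` (nonempty, pairwise disjoint,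
covering), and each of them has a sign. -/
def IsSignedPartition {n : ℕ} (Bs : List (Set (Elt n))) : Prop :=
  (∀ B ∈ Bs, B.Nonempty ∧ (IsPosBlock B ∨ IsNegBlock B)) ∧
  (Bs ++ Bs.map negBlock).Pairwise Disjoint ∧
  ∀ a : Elt n, ∃ B ∈ Bs ++ Bs.map negBlock, a ∈ B

/-- `-B_k < ⋯ < -B_1 < -1/2 < 1/2 < B_1 < ⋯ < B_k`, where consecutive `B_i` have opposite
signs. -/
def IsForm1 {n : ℕ} (O : BlockOrder n) : Prop :=
  ∃ D : List (Set (Elt n)), IsSignedPartition D ∧ D.IsChain OppSign ∧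
    O = ofList (symList [] D)

/-- `-B_k < ⋯ < -B_{l+1} < -1/2 < -B_l < ⋯ < -B_1 < B_1 < ⋯ < B_l < 1/2 < B_{l+1} < ⋯ < B_k`,
where `1 ≤ l ≤ k`, the size of `B_1` is greater than `1`, and consecutive blocks among
`B_1, …, B_l` and among `B_{l+1}, …, B_k` have opposite signs. Here `B₁ :: C` is the list
`[B_1, …, B_l]`. -/
def IsForm2 {n : ℕ} (O : BlockOrder n) : Prop :=
  ∃ (B₁ : Set (Elt n)) (C D : List (Set (Elt n))), IsSignedPartition ((B₁ :: C) ++ D) ∧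
    1 < B₁.ncard ∧ (B₁ :: C).IsChain OppSign ∧ D.IsChain OppSign ∧
    O = ofList (symList (B₁ :: C) D)

/-- `-B_k < ⋯ < -B_2 < -1/2 < -B_1 < B_1 < 1/2 < B_2 < ⋯ < B_k`, where `k ≥ 2`, the size of
`B_1` is `1`, `B_1` and `B_2` have the same sign, and consecutive blocks among `B_2, …, B_k`
have opposite signs. Here `B₂ :: D` is the list `[B_2, …, B_k]`. -/
def IsForm3 {n : ℕ} (O : BlockOrder n) : Prop :=
  ∃ (B₁ B₂ : Set (Elt n)) (D : List (Set (Elt n))), IsSignedPartition (B₁ :: B₂ :: D) ∧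
    B₁.ncard = 1 ∧ SameSign B₁ B₂ ∧ (B₂ :: D).IsChain OppSign ∧
    O = ofList (symList [B₁] (B₂ :: D))

end BoxedThreshold

/-!
A region of the arrangement is the set of all points with a given sign on each hyperplane, and on
it `≺` compares the values, at any one point of the region, of two elements of
`N ∪ {-1/2, 1/2}` separated by a hyperplane (`mem_regions_iff`, `prec_cell_iff`). The idea is to
choose in each region a point `x` so well adapted that the associated order can be read off its
coordinates: the blocks are then the level sets of `a ↦ x_a`, and `<` is the order of the values.

Such a point is called layered (`IsLayered`). Its levels carry a sign, and between two positive
levels of the same sign on the same side of `1/2` there is a level of the opposite sign. Hence two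
elements of the same sign on different levels have an element strictly between them for `≺`; near
the centre this needs the condition on the smallest level
(`IsLayered.exists_prec_prec`). So the classes of `∼` are the levels, and two levels are linked by
a chain for `≺` unless they are `{-a}` and `{a}` with `±a` alone in `(-1/2, 1/2)`, where the
convention supplies the relation (`IsLayered.regionOrder_cell`).

If `C` and `D` list the blocks of an order of one of the three forms, below and above `1/2`, then
giving these blocks increasing heights yields a point (`IsSignedPartition.exists_realizes`). It is
layered, and the order of its region is the given one (`Realizes.regionOrder_cell`), which proves
surjectivity. Conversely, every region contains such a point (`exists_admissible_pairwise`): cut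
the elements with value above `1/2`, and those with value in `(0, 1/2)`, into runs of equal sign.
The element of smallest absolute value below `1/2` is not separated from its negative, so it may be
replaced by it; its sign is chosen to agree with that of the next run, which gives form 2 if this
run lies below `1/2` and form 3 otherwise. As `n ≠ 1`, a next run exists. Finally, the order of the
values at `x` determines all the signs, hence the region (`cell_eq_of_levelOrder_eq`).
-/

namespace BoxedThreshold

variable {n : ℕ}

/-! ### Signed elements and the values of points -/

instance : Finite (Elt n) :=
  Finite.of_surjective (fun s : Fin n ⊕ Fin n => s.elim Elt.pos Elt.neg) fun a => by
    cases a with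
    | pos i => exact ⟨.inl i, rfl⟩
    | neg i => exact ⟨.inr i, rfl⟩

@[simp] theorem Elt.neg_pos (i : Fin n) : -(Elt.pos i) = Elt.neg i := rfl

@[simp] theorem Elt.neg_neg_eq (i : Fin n) : -(Elt.neg i) = Elt.pos i := rfl

instance : InvolutiveNeg (Elt n) where
  neg_neg a := by cases a <;> rfl

theorem Elt.isPos_neg (a : Elt n) : (-a).IsPos ↔ ¬ a.IsPos := by
  cases a <;> simp [Elt.IsPos]

theorem Elt.coord_neg (x : Fin n → ℝ) (a : Elt n) : (-a).coord x = -a.coord x := by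
  cases a <;> simp [Elt.coord]

/-- The value at `x` of a point of `N ∪ {-1/2, 1/2}`. -/
noncomputable def Pt.val (x : Fin n → ℝ) : Pt n → ℝ
  | .elt a => a.coord x
  | .negHalf => -(1 / 2)
  | .half => 1 / 2

/-- The pairs of points that are separated by a hyperplane of the arrangement: elements of `N`
with different signs and different absolute values, and an element of `N` together with `±1/2`. -/
def Comparable : Pt n → Pt n → Prop
  | .elt a, .elt b => b ≠ -a ∧ (a.IsPos ↔ ¬ b.IsPos)
  | .elt _, .half => True
  | .elt _, .negHalf => True
  | .half, .elt _ => True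
  | .negHalf, .elt _ => True
  | _, _ => False

theorem Comparable.symm {c d : Pt n} (h : Comparable c d) : Comparable d c := by
  rcases c with a | _ | _ <;> rcases d with b | _ | _ <;> simp_all [Comparable]
  intro h'
  exact h.1 (by rw [h', neg_neg])

/-- A point on none of the hyperplanes. -/
def Generic (x : Fin n → ℝ) : Prop :=
  ∀ c d, Comparable c d → c.val x ≠ d.val x

/-- The points that lie on the same side of every hyperplane as `x`. -/
def cell (x : Fin n → ℝ) : Set (Fin n → ℝ) :=
  {y | ∀ c d, Comparable c d → c.val x < d.val x → c.val y < d.val y}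

theorem mem_cell_self (x : Fin n → ℝ) : x ∈ cell x := fun _ _ _ h => h

/-! ### Regions are sign cells -/

theorem mem_compl_iff_generic {x : Fin n → ℝ} :
    x ∈ (⋃₀ arrangement n)ᶜ ↔ Generic x := by
  constructor
  · intro hx
    have h1 : ∀ i j, i ≠ j → x i + x j ≠ 0 := by
      intro i j hij h0
      rcases lt_or_gt_of_ne hij with h | h
      · exact hx ⟨_, Or.inl ⟨i, j, h, rfl⟩, h0⟩
      · exact hx ⟨_, Or.inl ⟨j, i, h, rfl⟩, by simpa [add_comm] using h0⟩
    have h2 : ∀ i, x i ≠ -(1 / 2) := fun i h0 => hx ⟨_, Or.inr (Or.inl ⟨i, rfl⟩), h0⟩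
    have h3 : ∀ i, x i ≠ 1 / 2 := fun i h0 => hx ⟨_, Or.inr (Or.inr ⟨i, rfl⟩), h0⟩
    have h4 : ∀ a : Elt n, a.coord x ≠ 1 / 2 ∧ a.coord x ≠ -(1 / 2) := by
      rintro (i | i)
      · exact ⟨h3 i, h2 i⟩
      · exact ⟨fun h => h2 i (by simp only [Elt.coord] at h; linarith),
          fun h => h3 i (by simp only [Elt.coord] at h; linarith)⟩
    intro c d hcd h
    rcases c with a | _ | _ <;> rcases d with b | _ | _ <;> simp only [Comparable, Pt.val] at hcd h
    · rcases a with i | i <;> rcases b with j | j <;>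
        simp only [Elt.IsPos, Elt.neg_pos, Elt.neg_neg_eq, Elt.coord, ne_eq, Elt.neg.injEq,
          Elt.pos.injEq] at hcd h
      · simp at hcd
      · exact h1 i j (fun e => hcd.1 e.symm) (by linarith)
      · exact h1 i j (fun e => hcd.1 e.symm) (by linarith)
      · simp at hcd
    · exact (h4 a).2 h
    · exact (h4 a).1 h
    · exact (h4 b).2 h.symm
    · exact (h4 b).1 h.symm
  · rintro hx ⟨H, (⟨i, j, hij, rfl⟩ | ⟨i, rfl⟩ | ⟨i, rfl⟩), h⟩
    · refine hx (.elt (.pos i)) (.elt (.neg j)) ?_ ?_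
      · simp [Comparable, Elt.IsPos, hij.ne']
      · simp only [Set.mem_ofPred_eq] at h
        simp only [Pt.val, Elt.coord]; linarith
    · exact hx (.elt (.pos i)) .negHalf trivial h
    · exact hx (.elt (.pos i)) .half trivial h

theorem generic_of_mem_cell {x y : Fin n → ℝ} (hx : Generic x) (hy : y ∈ cell x) : Generic y := by
  intro c d hcd
  rcases lt_or_gt_of_ne (hx c d hcd) with h | h
  · exact (hy c d hcd h).ne
  · exact (hy d c hcd.symm h).ne'

theorem cell_eq_of_mem {x y : Fin n → ℝ} (hx : Generic x) (hy : y ∈ cell x) :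
    cell y = cell x := by
  ext z
  refine ⟨fun hz c d hcd h => hz c d hcd (hy c d hcd h), fun hz c d hcd h => ?_⟩
  rcases lt_or_gt_of_ne (hx c d hcd) with h' | h'
  · exact hz c d hcd h'
  · exact absurd (hy d c hcd.symm h') h.not_gt

theorem continuous_val (c : Pt n) : Continuous fun x : Fin n → ℝ => c.val x := by
  rcases c with (i | i) | _ | _ <;> simp only [Pt.val, Elt.coord] <;> fun_prop

theorem val_convex_comb (c : Pt n) (y z : Fin n → ℝ) {s t : ℝ} (hst : s + t = 1) :
    c.val (s • y + t • z) = s * c.val y + t * c.val z := by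
  rcases c with (i | i) | _ | _ <;> simp only [Pt.val, Elt.coord, Pi.add_apply, Pi.smul_apply,
    smul_eq_mul]
  · ring
  · linear_combination (-(1 / 2) : ℝ) * hst.symm
  · linear_combination (1 / 2 : ℝ) * hst.symm

theorem convex_cell (x : Fin n → ℝ) : Convex ℝ (cell x) := by
  intro y hy z hz s t hs ht hst c d hcd h
  rw [val_convex_comb c y z hst, val_convex_comb d y z hst]
  have h1 := hy c d hcd h
  have h2 := hz c d hcd h
  rcases hs.eq_or_lt with rfl | hs
  · obtain rfl : t = 1 := by linarith
    simpa using h2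
  · nlinarith [mul_lt_mul_of_pos_left h1 hs, mul_le_mul_of_nonneg_left h2.le ht]

theorem connectedComponentIn_eq_cell {x : Fin n → ℝ} (hx : Generic x) :
    connectedComponentIn (⋃₀ arrangement n)ᶜ x = cell x := by
  have hxm := mem_compl_iff_generic.2 hx
  apply Set.Subset.antisymm
  · intro y hy c d hcd h
    by_contra hlt
    have hpre : IsPreconnected (connectedComponentIn (⋃₀ arrangement n)ᶜ x) :=
      isPreconnected_connectedComponentIn
    have hcont : Continuous fun z : Fin n → ℝ => d.val z - c.val z :=
      (continuous_val d).sub (continuous_val c)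
    obtain ⟨z, hz, h0⟩ := hpre.intermediate_value hy (mem_connectedComponentIn hxm)
      hcont.continuousOn (show (0 : ℝ) ∈ Set.Icc _ _ from ⟨by linarith, by linarith⟩)
    exact mem_compl_iff_generic.1 (connectedComponentIn_subset _ _ hz) c d hcd
      (by simp only at h0; linarith)
  · exact (convex_cell x).isPreconnected.subset_connectedComponentIn (mem_cell_self x)
      fun y hy => mem_compl_iff_generic.2 (generic_of_mem_cell hx hy)

theorem mem_regions_iff {R : Set (Fin n → ℝ)} :
    R ∈ regions (arrangement n) ↔ ∃ x, Generic x ∧ R = cell x := by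
  constructor
  · rintro ⟨x, hx, rfl⟩
    exact ⟨x, mem_compl_iff_generic.1 hx,
      connectedComponentIn_eq_cell (mem_compl_iff_generic.1 hx)⟩
  · rintro ⟨x, hx, rfl⟩
    exact ⟨x, mem_compl_iff_generic.2 hx, (connectedComponentIn_eq_cell hx).symm⟩

theorem prec_iff_comparable {R : Set (Fin n → ℝ)} {c d : Pt n} :
    Prec R c d ↔ Comparable c d ∧ ∀ y ∈ R, c.val y < d.val y := by
  rcases c with (i | i) | _ | _ <;> rcases d with (j | j) | _ | _ <;>
    simp [Prec, Comparable, Pt.val, Elt.coord, Elt.IsPos, lt_neg_iff_add_neg,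
      neg_lt_iff_pos_add, eq_comm, add_comm]

/-- On a region, `≺` compares the values of the separated pairs at any one of its points. -/
theorem prec_cell_iff {x : Fin n → ℝ} {c d : Pt n} :
    Prec (cell x) c d ↔ Comparable c d ∧ c.val x < d.val x := by
  rw [prec_iff_comparable]
  exact ⟨fun h => ⟨h.1, h.2 x (mem_cell_self x)⟩,
    fun h => ⟨h.1, fun y hy => hy c d h.1 h.2⟩⟩

/-! ### The order of the level sets of a point -/

/-- The elements of `N` on which `x` takes the same value as on `a`. -/
def levelSet (x : Fin n → ℝ) (a : Elt n) : Set (Elt n) := {b | b.coord x = a.coord x}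

/-- The item that a point belongs to: itself for `±1/2`, its level set for an element of `N`. -/
def levelItem (x : Fin n → ℝ) : Pt n → Item n
  | .elt a => .block (levelSet x a)
  | .negHalf => .negHalf
  | .half => .half

/-- The level sets of `x` and `±1/2`, ordered by the values of `x`. -/
def levelOrder (x : Fin n → ℝ) : BlockOrder n where
  carrier := Set.range (levelItem x)
  lt I J := ∃ c d, I = levelItem x c ∧ J = levelItem x d ∧ c.val x < d.val x

theorem levelSet_eq_of_coord_eq {x : Fin n → ℝ} {a b : Elt n} (h : a.coord x = b.coord x) :
    levelSet x a = levelSet x b := by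
  simp [levelSet, h]

theorem val_eq_of_levelItem_eq {x : Fin n → ℝ} {c d : Pt n}
    (h : levelItem x c = levelItem x d) : c.val x = d.val x := by
  rcases c with a | _ | _ <;> rcases d with b | _ | _ <;> simp [levelItem] at h ⊢
  have : a ∈ levelSet x b := h ▸ (rfl : a.coord x = a.coord x)
  exact this

theorem levelItem_eq_of_val_eq {x : Fin n → ℝ} (hx : Generic x) {c d : Pt n}
    (h : c.val x = d.val x) : levelItem x c = levelItem x d := by
  by_cases hcd : Comparable c d
  · exact absurd h (hx c d hcd)
  rcases c with a | _ | _ <;> rcases d with b | _ | _ <;>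
    simp only [Comparable, not_true_eq_false] at hcd
  · simp only [levelItem, levelSet_eq_of_coord_eq h]
  · rfl
  · norm_num [Pt.val] at h
  · norm_num [Pt.val] at h
  · rfl

theorem levelOrder_lt_iff {x : Fin n → ℝ} {c d : Pt n} :
    (levelOrder x).lt (levelItem x c) (levelItem x d) ↔ c.val x < d.val x := by
  refine ⟨?_, fun h => ⟨c, d, rfl, rfl, h⟩⟩
  rintro ⟨c', d', hc, hd, h⟩
  rwa [val_eq_of_levelItem_eq hc, val_eq_of_levelItem_eq hd]

theorem levelOrder_isTotalOrder {x : Fin n → ℝ} (hx : Generic x) :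
    (levelOrder x).IsTotalOrder := by
  refine ⟨?_, ?_, ?_, ?_⟩
  · rintro _ _ ⟨c, d, rfl, rfl, -⟩
    exact ⟨⟨c, rfl⟩, ⟨d, rfl⟩⟩
  · rintro _ ⟨c, d, rfl, h', h⟩
    exact h.ne (val_eq_of_levelItem_eq h')
  · rintro _ _ _ ⟨c, d, rfl, rfl, h⟩ ⟨d', e, h', rfl, h''⟩
    exact ⟨c, e, rfl, rfl, h.trans_eq (val_eq_of_levelItem_eq h') |>.trans h''⟩
  · rintro _ ⟨c, rfl⟩ _ ⟨d, rfl⟩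
    rcases lt_trichotomy (c.val x) (d.val x) with h | h | h
    · exact Or.inl ⟨c, d, rfl, rfl, h⟩
    · exact Or.inr (Or.inl (levelItem_eq_of_val_eq hx h))
    · exact Or.inr (Or.inr ⟨d, c, rfl, rfl, h⟩)

/-- The order of the level sets determines the cell. -/
theorem cell_eq_of_levelOrder_eq {x y : Fin n → ℝ} (hx : Generic x)
    (h : levelOrder x = levelOrder y) : cell x = cell y := by
  have hitem : ∀ c, levelItem x c = levelItem y c := by
    rintro (a | _ | _)
    · have : levelItem x (.elt a) ∈ (levelOrder y).carrier := h ▸ ⟨_, rfl⟩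
      obtain ⟨b | _ | _, hb⟩ := this <;> simp only [levelItem, Item.block.injEq, reduceCtorEq] at hb
      have hab : a ∈ levelSet y b := hb ▸ (rfl : a.coord x = a.coord x)
      simp only [levelItem, ← hb, levelSet_eq_of_coord_eq hab]
    · rfl
    · rfl
  have hmem : y ∈ cell x := by
    intro c d _ hlt
    rw [← levelOrder_lt_iff, h, hitem, hitem, levelOrder_lt_iff] at hlt
    exact hlt
  exact (cell_eq_of_mem hx hmem).symm

/-! ### Layered points -/

/-- A point whose level sets are the blocks of its region: every level set has a sign, between
two positive levels of the same sign on the same side of `1/2` there is a level of the opposite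
sign, and the levels closest to `0` are as in one of the three forms (no level in
`(-1/2, 1/2)`; a smallest positive level with at least two elements; a single element in
`(0, 1/2)`, of the same sign as the first level above `1/2`). -/
structure IsLayered (x : Fin n → ℝ) : Prop where
  generic : Generic x
  sign : ∀ a b : Elt n, a.coord x = b.coord x → (a.IsPos ↔ b.IsPos)
  alternating : ∀ a b : Elt n, 0 < a.coord x → a.coord x < b.coord x → (a.IsPos ↔ b.IsPos) →
    (b.coord x < 1 / 2 ∨ 1 / 2 < a.coord x) →
    ∃ c : Elt n, (c.IsPos ↔ ¬ a.IsPos) ∧ a.coord x < c.coord x ∧ c.coord x < b.coord x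
  middle : (∀ a : Elt n, 0 < a.coord x → 1 / 2 < a.coord x) ∨
    (∃ a b : Elt n, a ≠ b ∧ a.coord x = b.coord x ∧ 0 < a.coord x ∧ a.coord x < 1 / 2 ∧
      ∀ c : Elt n, 0 < c.coord x → a.coord x ≤ c.coord x) ∨
    (∃ a e : Elt n, 0 < a.coord x ∧ a.coord x < 1 / 2 ∧
      (∀ c : Elt n, 0 < c.coord x → c.coord x < 1 / 2 → c = a) ∧ (a.IsPos ↔ e.IsPos) ∧
      1 / 2 < e.coord x ∧ ∀ d : Elt n, 1 / 2 < d.coord x → e.coord x ≤ d.coord x)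

theorem Generic.coord_ne {x : Fin n → ℝ} (hx : Generic x) (a : Elt n) :
    a.coord x ≠ 1 / 2 ∧ a.coord x ≠ -(1 / 2) :=
  ⟨hx (.elt a) .half trivial, hx (.elt a) .negHalf trivial⟩

namespace IsLayered

variable {x : Fin n → ℝ}

theorem coord_ne_zero (hx : IsLayered x) (a : Elt n) : a.coord x ≠ 0 := by
  intro h
  have := hx.sign a (-a) (by rw [Elt.coord_neg, h, neg_zero])
  have := a.isPos_neg
  tauto

theorem prec_of_lt {a b : Elt n} (hs : a.IsPos ↔ ¬ b.IsPos) (hb : b ≠ -a)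
    (h : a.coord x < b.coord x) : Prec (cell x) (.elt a) (.elt b) :=
  prec_cell_iff.2 ⟨⟨hb, hs⟩, h⟩

/-- An element of the smallest positive level, when this level has at least two elements,
can be chosen different from any given element. -/
theorem exists_smallest_ne {a b : Elt n} (hab : a ≠ b) (h : a.coord x = b.coord x) (c : Elt n) :
    ∃ e : Elt n, e ≠ c ∧ e.coord x = a.coord x := by
  by_cases hc : a = c
  · exact ⟨b, fun hb => hab (hc.trans hb.symm), h.symm⟩
  · exact ⟨a, hc, rfl⟩

theorem exists_prec_prec (hx : IsLayered x) {a b : Elt n} (hs : a.IsPos ↔ b.IsPos)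
    (hlt : a.coord x < b.coord x) :
    ∃ c, Prec (cell x) (.elt a) c ∧ Prec (cell x) c (.elt b) := by
  have ha := hx.generic.coord_ne a
  have hb := hx.generic.coord_ne b
  have ha0 := hx.coord_ne_zero a
  have hb0 := hx.coord_ne_zero b
  have hna := a.isPos_neg
  have hnb := b.isPos_neg
  have hca := Elt.coord_neg x a
  have hcb := Elt.coord_neg x b
  by_cases h1 : a.coord x < -(1 / 2) ∧ -(1 / 2) < b.coord x
  · exact ⟨.negHalf, prec_cell_iff.2 ⟨trivial, h1.1⟩, prec_cell_iff.2 ⟨trivial, h1.2⟩⟩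
  by_cases h2 : a.coord x < 1 / 2 ∧ 1 / 2 < b.coord x
  · exact ⟨.half, prec_cell_iff.2 ⟨trivial, h2.1⟩, prec_cell_iff.2 ⟨trivial, h2.2⟩⟩
  rcases lt_or_gt_of_ne ha0.symm with hpos | hneg
  · obtain ⟨c, hc, hac, hcb'⟩ := hx.alternating a b hpos hlt hs (by
      rcases lt_or_gt_of_ne hb.1 with h | h
      · exact Or.inl h
      · rcases lt_or_gt_of_ne ha.1 with h' | h'
        · exact absurd ⟨h', h⟩ h2
        · exact Or.inr h')
    refine ⟨.elt c, prec_of_lt (by clear * - hc; tauto) ?_ hac,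
      prec_of_lt (by clear * - hc hs; tauto) ?_ hcb'⟩
    · rintro rfl; linarith
    · rintro rfl; rw [Elt.coord_neg] at hcb'; linarith
  rcases lt_or_gt_of_ne hb0 with hbneg | hbpos
  · obtain ⟨c, hc, hac, hcb'⟩ := hx.alternating (-b) (-a) (by linarith) (by linarith)
      (by clear * - hs hna hnb; tauto) (by
      rw [hca, hcb]
      rcases lt_or_gt_of_ne ha.2 with h | h
      · rcases lt_or_gt_of_ne hb.2 with h' | h'
        · exact Or.inr (by linarith)
        · exact absurd ⟨h, h'⟩ h1
      · exact Or.inl (by linarith))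
    have hcc := Elt.coord_neg x c
    have hnc := c.isPos_neg
    refine ⟨.elt (-c), prec_of_lt (by clear * - hc hs hnb hnc; tauto) ?_ (by linarith),
      prec_of_lt (by clear * - hc hnb hnc; tauto) ?_ (by linarith)⟩
    · intro h; rw [h] at hcc; linarith
    · intro h; rw [neg_neg] at h; subst h; linarith
  have ha1 : -(1 / 2) < a.coord x := by
    by_contra h
    exact h1 ⟨lt_of_le_of_ne (not_lt.1 h) ha.2, by linarith⟩
  have hb1 : b.coord x < 1 / 2 := by
    by_contra h
    exact h2 ⟨by linarith, lt_of_le_of_ne (not_lt.1 h) hb.1.symm⟩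
  rcases hx.middle with hm | ⟨e₁, e₂, hne, heq, he0, he1, hmin⟩ | ⟨e, -, -, -, huniq, -⟩
  · have := hm b hbpos
    linarith
  · have hma := hmin (-a) (by linarith)
    have hmb := hmin b hbpos
    by_cases hse : e₁.IsPos ↔ a.IsPos
    · obtain ⟨e, heb, hev⟩ := exists_smallest_ne hne heq b
      have hes := hx.sign e e₁ hev
      have hce := Elt.coord_neg x e
      have hns := e.isPos_neg
      have hstrict : a.coord x ≠ (-e).coord x := fun h => by
        have := hx.sign _ _ h
        clear * - this hns hes hse
        tauto
      have hlt : a.coord x < (-e).coord x := lt_of_le_of_ne (by linarith) hstrict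
      refine ⟨.elt (-e), prec_of_lt (by clear * - hse hes hns; tauto) ?_ hlt,
        prec_of_lt (by clear * - hse hes hns hs; tauto) ?_ (by linarith)⟩
      · intro h; rw [h] at hce hlt; linarith
      · rw [neg_neg]; exact heb.symm
    · obtain ⟨e, hea, hev⟩ := exists_smallest_ne hne heq (-a)
      have hes := hx.sign e e₁ hev
      have hstrict : e.coord x ≠ b.coord x := fun h => by
        have := hx.sign _ _ h
        clear * - this hes hse hs
        tauto
      refine ⟨.elt e, prec_of_lt (by clear * - hse hes; tauto) hea (by linarith),
        prec_of_lt (by clear * - hse hes hs; tauto) ?_ (lt_of_le_of_ne (by linarith) hstrict)⟩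
      rintro rfl
      rw [neg_neg] at hcb
      linarith
  · have h3 := huniq b hbpos hb1
    have h4 := huniq (-a) (by linarith) (by linarith)
    rw [h3, ← h4] at hs
    clear * - hs hna
    tauto

theorem sim_iff (hx : IsLayered x) {a b : Elt n} :
    Sim (cell x) a b ↔ b.coord x = a.coord x := by
  constructor
  · rintro ⟨hs, hno⟩
    rcases lt_trichotomy (a.coord x) (b.coord x) with h | h | h
    · obtain ⟨c, hc⟩ := hx.exists_prec_prec hs h
      exact absurd ⟨c, Or.inl hc⟩ hno
    · exact h.symm
    · obtain ⟨c, hc⟩ := hx.exists_prec_prec hs.symm h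
      exact absurd ⟨c, Or.inr hc⟩ hno
  · intro h
    refine ⟨hx.sign _ _ h.symm, ?_⟩
    rintro ⟨c, ⟨h1, h2⟩ | ⟨h1, h2⟩⟩
    · have := (prec_cell_iff.1 h1).2.trans (prec_cell_iff.1 h2).2
      exact this.ne h.symm
    · have := (prec_cell_iff.1 h1).2.trans (prec_cell_iff.1 h2).2
      exact this.ne h

theorem isBlock_iff (hx : IsLayered x) {B : Set (Elt n)} :
    IsBlock (cell x) B ↔ ∃ a, B = levelSet x a := by
  simp only [IsBlock, levelSet, hx.sim_iff]

theorem val_lt_of_transGen {c d : Pt n} (h : Relation.TransGen (Prec (cell x)) c d) :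
    c.val x < d.val x := by
  induction h with
  | single h => exact (prec_cell_iff.1 h).2
  | tail _ h ih => exact ih.trans (prec_cell_iff.1 h).2

theorem baseLt_levelSet_half_iff (hx : IsLayered x) {a : Elt n} :
    BaseLt (cell x) .half (.block (levelSet x a)) ↔ 1 / 2 < a.coord x := by
  constructor
  · rintro ⟨-, b, hb, h⟩
    have := (prec_cell_iff.1 h).2
    rwa [← show b.coord x = a.coord x from hb]
  · exact fun h => ⟨hx.isBlock_iff.2 ⟨a, rfl⟩, a, rfl, prec_cell_iff.2 ⟨trivial, h⟩⟩

theorem levelOrder_lt_of_baseLt (hx : IsLayered x) {I J : Item n} (h : BaseLt (cell x) I J) :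
    (levelOrder x).lt I J := by
  rcases I with B | _ | _ <;> rcases J with B' | _ | _ <;> simp only [BaseLt] at h
  · obtain ⟨hB, hB', b, hb, b', hb', h⟩ := h
    obtain ⟨a, rfl⟩ := hx.isBlock_iff.1 hB
    obtain ⟨a', rfl⟩ := hx.isBlock_iff.1 hB'
    refine ⟨.elt b, .elt b', ?_, ?_, val_lt_of_transGen h⟩
    · simp only [levelItem, levelSet_eq_of_coord_eq hb]
    · simp only [levelItem, levelSet_eq_of_coord_eq hb']
  · obtain ⟨hB, b, hb, h⟩ := h
    obtain ⟨a, rfl⟩ := hx.isBlock_iff.1 hB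
    exact ⟨.elt b, .negHalf, by simp only [levelItem, levelSet_eq_of_coord_eq hb], rfl,
      (prec_cell_iff.1 h).2⟩
  · obtain ⟨hB, b, hb, h⟩ := h
    obtain ⟨a, rfl⟩ := hx.isBlock_iff.1 hB
    exact ⟨.elt b, .half, by simp only [levelItem, levelSet_eq_of_coord_eq hb], rfl,
      (prec_cell_iff.1 h).2⟩
  · obtain ⟨hB, b, hb, h⟩ := h
    obtain ⟨a, rfl⟩ := hx.isBlock_iff.1 hB
    exact ⟨.negHalf, .elt b, rfl, by simp only [levelItem, levelSet_eq_of_coord_eq hb],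
      (prec_cell_iff.1 h).2⟩
  · exact ⟨.negHalf, .half, rfl, rfl, by norm_num [Pt.val]⟩
  · obtain ⟨hB, b, hb, h⟩ := h
    obtain ⟨a, rfl⟩ := hx.isBlock_iff.1 hB
    exact ⟨.half, .elt b, rfl, by simp only [levelItem, levelSet_eq_of_coord_eq hb],
      (prec_cell_iff.1 h).2⟩

theorem isFirstAfterHalf_levelSet_iff (hx : IsLayered x) {a : Elt n} :
    IsFirstAfterHalf (cell x) (levelSet x a) ↔
      1 / 2 < a.coord x ∧ ∀ d : Elt n, 1 / 2 < d.coord x → a.coord x ≤ d.coord x := by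
  rw [IsFirstAfterHalf, hx.baseLt_levelSet_half_iff]
  refine and_congr_right fun ha => ⟨fun h d hd => ?_, ?_⟩
  · by_contra! hlt
    refine h (levelSet x d) ⟨hx.baseLt_levelSet_half_iff.2 hd, hx.isBlock_iff.2 ⟨d, rfl⟩,
      hx.isBlock_iff.2 ⟨a, rfl⟩, d, rfl, a, rfl, ?_⟩
    by_cases hs : d.IsPos ↔ a.IsPos
    · obtain ⟨c, h1, h2⟩ := hx.exists_prec_prec hs hlt
      exact .head h1 (.single h2)
    · refine .single (prec_of_lt (by tauto) ?_ hlt)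
      rintro rfl
      rw [Elt.coord_neg] at ha
      linarith
  · rintro h B' ⟨h1, h2⟩
    obtain ⟨d, rfl⟩ := hx.isBlock_iff.1 h1.1
    have h3 := h d (hx.baseLt_levelSet_half_iff.1 h1)
    have h4 := hx.levelOrder_lt_of_baseLt h2
    have h5 : d.coord x < a.coord x := (levelOrder_lt_iff (c := .elt d) (d := .elt a)).1 h4
    exact h3.not_gt h5

theorem isMiddle_iff {i : Fin n} : IsMiddle (cell x) i ↔ -(1 / 2) < x i ∧ x i < 1 / 2 := by
  simp [IsMiddle, prec_cell_iff, Comparable, Pt.val, Elt.coord]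

theorem levelSet_eq_singleton {a e : Elt n} (h0 : -(1 / 2) < a.coord x) (h1 : a.coord x < 1 / 2)
    (ha : a.coord x ≠ 0)
    (huniq : ∀ c : Elt n, 0 < c.coord x → c.coord x < 1 / 2 → c = e) : levelSet x a = {a} := by
  ext c
  refine ⟨fun hc => ?_, fun hc => by rw [hc]; rfl⟩
  have hc : c.coord x = a.coord x := hc
  rcases lt_or_gt_of_ne ha with h | h
  · have h2 := huniq (-a) (by rw [Elt.coord_neg]; linarith) (by rw [Elt.coord_neg]; linarith)
    have h3 := huniq (-c) (by rw [Elt.coord_neg]; linarith) (by rw [Elt.coord_neg]; linarith)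
    exact neg_injective (h3.trans h2.symm)
  · exact (huniq c (by linarith) (by linarith)).trans (huniq a h h1).symm

theorem levelOrder_lt_of_convLt (hx : IsLayered x) {I J : Item n} (h : ConvLt (cell x) I J) :
    (levelOrder x).lt I J := by
  obtain ⟨i, hi, huniq, B, hB, hIJ⟩ := h
  rw [isMiddle_iff] at hi
  have hi0 := hx.coord_ne_zero (.pos i)
  have hi0' := hx.coord_ne_zero (.neg i)
  simp only [Elt.coord] at hi0
  have hmid : ∀ a : Elt n, -(1 / 2) < a.coord x → a.coord x < 1 / 2 → a = .pos i ∨ a = .neg i := by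
    rintro (j | j) h1 h2
    · exact Or.inl (by rw [huniq j (isMiddle_iff.2 ⟨h1, h2⟩)])
    · simp only [Elt.coord] at h1 h2
      exact Or.inr (by rw [huniq j (isMiddle_iff.2 ⟨by linarith, by linarith⟩)])
  rcases hx.middle with hm | ⟨e₁, e₂, hne, heq, he0, he1, -⟩ | ⟨a, e, ha0, ha1, hu, hs, he, hmin⟩
  · rcases lt_or_gt_of_ne hi0 with h | h
    · have := hm (.neg i) (by simp only [Elt.coord]; linarith)
      simp only [Elt.coord] at this
      linarith
    · have := hm (.pos i) h
      simp only [Elt.coord] at this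
      linarith
  · rcases hmid e₁ (by linarith) he1 with rfl | rfl <;>
      rcases hmid e₂ (by linarith) (by linarith) with rfl | rfl <;>
      simp only [Elt.coord, ne_eq, not_true_eq_false] at hne heq he0 <;> linarith
  · obtain ⟨d, rfl⟩ := hx.isBlock_iff.1 hB.1.1
    rw [hx.isFirstAfterHalf_levelSet_iff] at hB
    have hsd := hx.sign e d (le_antisymm (hmin d hB.1) (hB.2 e he))
    have hpos : levelSet x (.pos i) = {.pos i} := levelSet_eq_singleton hi.1 hi.2 hi0 hu
    have hneg : levelSet x (.neg i) = {.neg i} :=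
      levelSet_eq_singleton (by simp only [Elt.coord]; linarith) (by simp only [Elt.coord]; linarith)
        hi0' hu
    rcases hIJ with ⟨hP, rfl, rfl⟩ | ⟨hN, rfl, rfl⟩
    · refine ⟨.elt (.neg i), .elt (.pos i), by rw [levelItem, hneg], by rw [levelItem, hpos], ?_⟩
      have hd : d.IsPos := hP d rfl
      rcases hmid a (by linarith) ha1 with rfl | rfl
      · simp only [Pt.val, Elt.coord] at ha0 ⊢
        linarith
      · simp only [Elt.IsPos, false_iff] at hs
        tauto
    · refine ⟨.elt (.pos i), .elt (.neg i), by rw [levelItem, hpos], by rw [levelItem, hneg], ?_⟩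
      have hd : ¬ d.IsPos := hN d rfl
      rcases hmid a (by linarith) ha1 with rfl | rfl
      · simp only [Elt.IsPos, true_iff] at hs
        tauto
      · simp only [Pt.val, Elt.coord] at ha0 ⊢
        linarith

theorem convLt_of_unique_middle (hx : IsLayered x) {a e : Elt n} (ha0 : 0 < a.coord x)
    (ha1 : a.coord x < 1 / 2) (hu : ∀ c : Elt n, 0 < c.coord x → c.coord x < 1 / 2 → c = a)
    (hs : a.IsPos ↔ e.IsPos) (he : 1 / 2 < e.coord x)
    (hmin : ∀ d : Elt n, 1 / 2 < d.coord x → e.coord x ≤ d.coord x) :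
    ConvLt (cell x) (.block {-a}) (.block {a}) := by
  have hfirst := hx.isFirstAfterHalf_levelSet_iff.2 ⟨he, hmin⟩
  have hmid : ∀ j, IsMiddle (cell x) j → Elt.pos j = a ∨ Elt.neg j = a := by
    intro j hj
    rw [isMiddle_iff] at hj
    rcases lt_or_gt_of_ne (hx.coord_ne_zero (.pos j)) with h | h <;> simp only [Elt.coord] at h
    · exact Or.inr (hu _ (by simp only [Elt.coord]; linarith) (by simp only [Elt.coord]; linarith))
    · exact Or.inl (hu _ h hj.2)
  rcases a with i | i
  · refine ⟨i, isMiddle_iff.2 ?_, ?_, levelSet x e, hfirst, Or.inl ⟨?_, rfl, rfl⟩⟩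
    · simp only [Elt.coord] at ha0 ha1
      exact ⟨by linarith, ha1⟩
    · intro j hj
      simpa using hmid j hj
    · intro b hb
      exact (hx.sign b e hb).2 (hs.1 trivial)
  · refine ⟨i, isMiddle_iff.2 ?_, ?_, levelSet x e, hfirst, Or.inr ⟨?_, rfl, rfl⟩⟩
    · simp only [Elt.coord] at ha0 ha1
      exact ⟨by linarith, by linarith⟩
    · intro j hj
      simpa using hmid j hj
    · intro b hb hbp
      exact hs.2 ((hx.sign b e hb).1 hbp)

theorem baseLt_or_convLt_levelSet (hx : IsLayered x) {a b : Elt n}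
    (h : a.coord x < b.coord x) :
    BaseLt (cell x) (.block (levelSet x a)) (.block (levelSet x b)) ∨
      ConvLt (cell x) (.block (levelSet x a)) (.block (levelSet x b)) := by
  have key : ∀ b', b'.coord x = b.coord x → Relation.TransGen (Prec (cell x)) (.elt a) (.elt b') →
      BaseLt (cell x) (.block (levelSet x a)) (.block (levelSet x b)) := fun b' hb' ht =>
    ⟨hx.isBlock_iff.2 ⟨a, rfl⟩, hx.isBlock_iff.2 ⟨b, rfl⟩, a, rfl, b', hb', ht⟩
  by_cases hs : a.IsPos ↔ b.IsPos
  · obtain ⟨c, h1, h2⟩ := hx.exists_prec_prec hs h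
    exact Or.inl (key b rfl (.head h1 (.single h2)))
  by_cases hba : b ≠ -a
  · exact Or.inl (key b rfl (.single (prec_of_lt (by tauto) hba h)))
  -- The remaining case `b = -a` is the only one in which `≺` alone may not suffice.
  push Not at hba
  subst hba
  have hca := Elt.coord_neg x a
  have hna := a.isPos_neg
  rcases lt_or_gt_of_ne (hx.generic.coord_ne a).2 with h1 | h1
  · have h2 : Prec (cell x) (.elt a) .negHalf := prec_cell_iff.2 ⟨trivial, h1⟩
    have h3 : Prec (cell x) .negHalf (.elt (-a)) :=
      prec_cell_iff.2 ⟨trivial, by simp only [Pt.val]; linarith⟩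
    exact Or.inl (key _ rfl (.head h2 (.single h3)))
  rcases hx.middle with hm | ⟨e₁, e₂, hne, heq, he0, he1, hmin⟩ | ⟨e, f, he0, he1, hu, hs', hf, hmin⟩
  · have := hm (-a) (by linarith)
    linarith
  · rcases (hmin (-a) (by linarith)).eq_or_lt with hm | hm
    · obtain ⟨e, hea, hev⟩ := exists_smallest_ne hne heq (-a)
      have := hx.sign _ _ (hev.trans hm)
      exact Or.inl (key e (hev.trans hm) (.single (prec_of_lt (by tauto) hea (by linarith))))
    · obtain ⟨c, hc, hc1, hc2⟩ : ∃ c : Elt n, (c.IsPos ↔ ¬ a.IsPos) ∧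
          a.coord x < c.coord x ∧ c.coord x < (-a).coord x := by
        have hce := Elt.coord_neg x e₁
        have hne := e₁.isPos_neg
        by_cases he : e₁.IsPos ↔ a.IsPos
        · exact ⟨-e₁, by tauto, by linarith, by linarith⟩
        · exact ⟨e₁, by tauto, by linarith, hm⟩
      obtain ⟨d, h2, h3⟩ := hx.exists_prec_prec (a := c) (b := -a) (by tauto) hc2
      refine Or.inl (key _ rfl (.head (prec_of_lt (by tauto) ?_ hc1) (.head h2 (.single h3))))
      rintro rfl
      exact hc2.ne rfl
  · have hae : -a = e := hu (-a) (by linarith) (by linarith)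
    right
    rw [levelSet_eq_singleton (a := a) h1 (by linarith) (by linarith) hu,
      levelSet_eq_singleton (a := -a) (by linarith) (by linarith) (by linarith) hu]
    subst hae
    have := hx.convLt_of_unique_middle he0 he1 hu hs' hf hmin
    rwa [neg_neg] at this

/-- The order associated to the region of a layered point is the order of its level sets. -/
theorem regionOrder_cell (hx : IsLayered x) : regionOrder (cell x) = levelOrder x := by
  ext I J
  · constructor
    · rintro (rfl | rfl | ⟨B, hB, rfl⟩)
      · exact ⟨.negHalf, rfl⟩
      · exact ⟨.half, rfl⟩
      · obtain ⟨a, rfl⟩ := hx.isBlock_iff.1 hB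
        exact ⟨.elt a, rfl⟩
    · rintro ⟨a | _ | _, rfl⟩
      · exact Or.inr (Or.inr ⟨_, hx.isBlock_iff.2 ⟨a, rfl⟩, rfl⟩)
      · exact Or.inl rfl
      · exact Or.inr (Or.inl rfl)
  · constructor
    · rintro (h | h)
      · exact hx.levelOrder_lt_of_baseLt h
      · exact hx.levelOrder_lt_of_convLt h
    · rintro ⟨c, d, rfl, rfl, h⟩
      rcases c with a | _ | _ <;> rcases d with b | _ | _
      · exact hx.baseLt_or_convLt_levelSet h
      · exact Or.inl ⟨hx.isBlock_iff.2 ⟨a, rfl⟩, a, rfl, prec_cell_iff.2 ⟨trivial, h⟩⟩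
      · exact Or.inl ⟨hx.isBlock_iff.2 ⟨a, rfl⟩, a, rfl, prec_cell_iff.2 ⟨trivial, h⟩⟩
      · exact Or.inl ⟨hx.isBlock_iff.2 ⟨b, rfl⟩, b, rfl, prec_cell_iff.2 ⟨trivial, h⟩⟩
      · exact absurd h (lt_irrefl _)
      · exact Or.inl trivial
      · exact Or.inl ⟨hx.isBlock_iff.2 ⟨b, rfl⟩, b, rfl, prec_cell_iff.2 ⟨trivial, h⟩⟩
      · norm_num [Pt.val] at h
      · exact absurd h (lt_irrefl _)

end IsLayered

/-! ### Signed partitions and the lists of the three forms -/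

theorem mem_negBlock {B : Set (Elt n)} {a : Elt n} : a ∈ negBlock B ↔ -a ∈ B := by
  constructor
  · rintro ⟨b, hb, rfl⟩
    simpa using hb
  · exact fun h => ⟨-a, h, neg_neg a⟩

theorem disjoint_negBlock_negBlock {B B' : Set (Elt n)} :
    Disjoint (negBlock B) (negBlock B') ↔ Disjoint B B' :=
  Set.disjoint_image_iff neg_injective

theorem isSignedPartition_iff {Bs : List (Set (Elt n))} :
    IsSignedPartition Bs ↔ (∀ B ∈ Bs, B.Nonempty ∧ (IsPosBlock B ∨ IsNegBlock B)) ∧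
      Bs.Pairwise Disjoint ∧ (∀ B ∈ Bs, ∀ B' ∈ Bs, ∀ a ∈ B, -a ∉ B') ∧
      ∀ a : Elt n, ∃ B ∈ Bs, a ∈ B ∨ -a ∈ B := by
  refine and_congr_right fun _ => ?_
  rw [List.pairwise_append, List.pairwise_map]
  simp only [disjoint_negBlock_negBlock, List.mem_append, List.mem_map]
  constructor
  · rintro ⟨⟨h1, -, h2⟩, h3⟩
    refine ⟨h1, fun B hB B' hB' a ha ha' => ?_, fun a => ?_⟩
    · exact Set.disjoint_left.1 (h2 B hB _ ⟨B', hB', rfl⟩) ha (mem_negBlock.2 ha')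
    · obtain ⟨B, hB | ⟨B', hB', rfl⟩, ha⟩ := h3 a
      · exact ⟨B, hB, Or.inl ha⟩
      · exact ⟨B', hB', Or.inr (mem_negBlock.1 ha)⟩
  · rintro ⟨h1, h2, h3⟩
    refine ⟨⟨h1, h1, ?_⟩, fun a => ?_⟩
    · rintro B hB _ ⟨B', hB', rfl⟩
      exact Set.disjoint_left.2 fun a ha ha' => h2 B hB B' hB' a ha (mem_negBlock.1 ha')
    · obtain ⟨B, hB, ha | ha⟩ := h3 a
      · exact ⟨B, Or.inl hB, ha⟩
      · exact ⟨_, Or.inr ⟨B, hB, rfl⟩, mem_negBlock.2 ha⟩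

/-- The lists `C = [B_1, …, B_l]` and `D = [B_{l+1}, …, B_k]` of the blocks above the centre in
an order of one of the three forms. -/
def IsAdmissible (C D : List (Set (Elt n))) : Prop :=
  IsSignedPartition (C ++ D) ∧ C.IsChain OppSign ∧ D.IsChain OppSign ∧
    (C = [] ∨ (∃ B₁ C', C = B₁ :: C' ∧ 1 < B₁.ncard) ∨
      ∃ B₁ B₂ D', C = [B₁] ∧ D = B₂ :: D' ∧ B₁.ncard = 1 ∧ SameSign B₁ B₂)

theorem isForm_iff {O : BlockOrder n} :
    (IsForm1 O ∨ IsForm2 O ∨ IsForm3 O) ↔ ∃ C D, IsAdmissible C D ∧ O = ofList (symList C D) := by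
  constructor
  · rintro (⟨D, hp, hD, rfl⟩ | ⟨B₁, C, D, hp, hB, hC, hD, rfl⟩ | ⟨B₁, B₂, D, hp, hB, hs, hD, rfl⟩)
    · exact ⟨[], D, ⟨hp, .nil, hD, Or.inl rfl⟩, rfl⟩
    · exact ⟨_, D, ⟨hp, hC, hD, Or.inr (Or.inl ⟨B₁, C, rfl, hB⟩)⟩, rfl⟩
    · exact ⟨_, _, ⟨hp, .singleton _, hD, Or.inr (Or.inr ⟨B₁, B₂, D, rfl, rfl, hB, hs⟩)⟩, rfl⟩
  · rintro ⟨C, D, ⟨hp, hC, hD, rfl | ⟨B₁, C', rfl, hB⟩ | ⟨B₁, B₂, D', rfl, rfl, hB, hs⟩⟩, rfl⟩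
    · exact Or.inl ⟨D, hp, hD, rfl⟩
    · exact Or.inr (Or.inl ⟨B₁, C', D, hp, hB, hC, hD, rfl⟩)
    · exact Or.inr (Or.inr ⟨B₁, B₂, D', hp, hB, hs, hD, rfl⟩)

/-- The points that an item consists of. -/
def Item.pts : Item n → Set (Pt n)
  | .block B => Pt.elt '' B
  | .negHalf => {.negHalf}
  | .half => {.half}

/-- The reflection of the points of `N ∪ {-1/2, 1/2}` in the centre. -/
def Pt.reflect : Pt n → Pt n
  | .elt a => .elt (-a)
  | .negHalf => .half
  | .half => .negHalf

/-- The reflection of the items in the centre. -/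
def Item.reflect : Item n → Item n
  | .block B => .block (negBlock B)
  | .negHalf => .half
  | .half => .negHalf

theorem Pt.val_reflect (x : Fin n → ℝ) (c : Pt n) : c.reflect.val x = -c.val x := by
  rcases c with a | _ | _ <;> simp [Pt.reflect, Pt.val, Elt.coord_neg]

theorem Comparable.reflect {c d : Pt n} (h : Comparable c d) : Comparable c.reflect d.reflect := by
  rcases c with a | _ | _ <;> rcases d with b | _ | _ <;>
    simp_all [Comparable, Pt.reflect, Elt.isPos_neg]
  intro h'
  exact h.1 (by rw [← h', neg_neg])

theorem Pt.reflect_reflect (c : Pt n) : c.reflect.reflect = c := by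
  rcases c with a | _ | _ <;> simp [Pt.reflect]

theorem Item.reflect_mem_pts {I : Item n} {c : Pt n} (h : c ∈ I.reflect.pts) :
    c.reflect ∈ I.pts := by
  rcases I with B | _ | _
  · obtain ⟨b, hb, rfl⟩ := h
    exact ⟨-b, mem_negBlock.1 hb, rfl⟩
  · cases h; rfl
  · cases h; rfl

/-- The part of `symList C D` above the centre. -/
def upperList (C D : List (Set (Elt n))) : List (Item n) :=
  C.map Item.block ++ [Item.half] ++ D.map Item.block

theorem symList_eq (C D : List (Set (Elt n))) :
    symList C D = ((upperList C D).map Item.reflect).reverse ++ upperList C D := by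
  simp [symList, upperList, Item.reflect, Function.comp_def]

theorem pairwise_symList {C D : List (Set (Elt n))} {Q : Pt n → Pt n → Prop}
    (hQ : ∀ c d, Q c.reflect d.reflect → Q d c)
    (h : (upperList C D).Pairwise fun I J => ∀ c ∈ I.pts, ∀ d ∈ J.pts, Q c d)
    (h' : ∀ I ∈ upperList C D, ∀ J ∈ upperList C D, ∀ c ∈ I.pts, ∀ d ∈ J.pts, Q c.reflect d) :
    (symList C D).Pairwise fun I J => ∀ c ∈ I.pts, ∀ d ∈ J.pts, Q c d := by
  rw [symList_eq, List.pairwise_append, List.pairwise_reverse, List.pairwise_map]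
  refine ⟨h.imp fun {I J} hIJ c hc d hd => ?_, h, fun I hI J hJ c hc d hd => ?_⟩
  · exact hQ _ _ (hIJ _ (Item.reflect_mem_pts hd) _ (Item.reflect_mem_pts hc))
  · rw [List.mem_reverse, List.mem_map] at hI
    obtain ⟨I', hI', rfl⟩ := hI
    have := h' I' hI' J hJ _ (Item.reflect_mem_pts hc) d hd
    rwa [Pt.reflect_reflect] at this

theorem pairwise_upperList {C D : List (Set (Elt n))} {Q : Pt n → Pt n → Prop}
    (hC : C.Pairwise fun B B' => ∀ b ∈ B, ∀ b' ∈ B', Q (.elt b) (.elt b'))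
    (hD : D.Pairwise fun B B' => ∀ b ∈ B, ∀ b' ∈ B', Q (.elt b) (.elt b'))
    (hCD : ∀ B ∈ C, ∀ B' ∈ D, ∀ b ∈ B, ∀ b' ∈ B', Q (.elt b) (.elt b'))
    (hCh : ∀ B ∈ C, ∀ b ∈ B, Q (.elt b) .half) (hDh : ∀ B ∈ D, ∀ b ∈ B, Q .half (.elt b)) :
    (upperList C D).Pairwise fun I J => ∀ c ∈ I.pts, ∀ d ∈ J.pts, Q c d := by
  simp only [upperList, List.append_assoc, List.pairwise_append, List.pairwise_map, List.mem_map,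
    List.singleton_append, List.pairwise_cons, List.mem_cons, forall_exists_index,
    and_imp, forall_apply_eq_imp_iff₂, Item.pts, Set.mem_image, Set.mem_singleton_iff,
    forall_eq]
  refine ⟨hC, ⟨hDh, hD⟩, ?_⟩
  rintro B hB J (rfl | ⟨B', hB', rfl⟩) b hb d hd
  · cases hd; exact hCh B hB b hb
  · obtain ⟨b', hb', rfl⟩ := hd
    exact hCD B hB B' hB' b hb b' hb'

theorem exists_of_mem_upperList {C D : List (Set (Elt n))} {I : Item n} (hI : I ∈ upperList C D)
    {c : Pt n} (hc : c ∈ I.pts) : c = .half ∨ ∃ B ∈ C ++ D, ∃ b ∈ B, c = .elt b := by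
  simp only [upperList, List.mem_append, List.mem_map, List.mem_singleton] at hI
  rcases hI with (⟨B, hB, rfl⟩ | rfl) | ⟨B, hB, rfl⟩
  · obtain ⟨b, hb, rfl⟩ := hc
    exact Or.inr ⟨B, by simp [hB], b, hb, rfl⟩
  · exact Or.inl hc
  · obtain ⟨b, hb, rfl⟩ := hc
    exact Or.inr ⟨B, by simp [hB], b, hb, rfl⟩

theorem block_mem_symList {C D : List (Set (Elt n))} {B : Set (Elt n)} :
    Item.block B ∈ symList C D ↔ B ∈ C ++ D ∨ ∃ B' ∈ C ++ D, negBlock B' = B := by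
  simp only [symList, List.mem_append, List.mem_reverse, List.mem_map, List.mem_singleton,
    Item.block.injEq, exists_eq_right, reduceCtorEq, or_false]
  constructor
  · rintro (((⟨B', h, e⟩ | ⟨B', h, e⟩) | h) | h)
    · exact Or.inr ⟨B', Or.inr h, e⟩
    · exact Or.inr ⟨B', Or.inl h, e⟩
    · exact Or.inl (Or.inl h)
    · exact Or.inl (Or.inr h)
  · rintro ((h | h) | ⟨B', h | h, e⟩)
    · exact Or.inl (Or.inr h)
    · exact Or.inr h
    · exact Or.inl (Or.inl (Or.inr ⟨B', h, e⟩))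
    · exact Or.inl (Or.inl (Or.inl ⟨B', h, e⟩))

theorem IsSignedPartition.exists_mem_symList {C D : List (Set (Elt n))}
    (h : IsSignedPartition (C ++ D)) (c : Pt n) : ∃ I ∈ symList C D, c ∈ I.pts := by
  rcases c with a | _ | _
  · obtain ⟨B, hB, ha | ha⟩ := (isSignedPartition_iff.1 h).2.2.2 a
    · exact ⟨.block B, block_mem_symList.2 (Or.inl hB), a, ha, rfl⟩
    · exact ⟨.block (negBlock B), block_mem_symList.2 (Or.inr ⟨B, hB, rfl⟩), a,
        mem_negBlock.2 ha, rfl⟩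
  · exact ⟨.negHalf, by simp [symList], rfl⟩
  · exact ⟨.half, by simp [symList], rfl⟩

theorem IsSignedPartition.nonempty_pts {C D : List (Set (Elt n))}
    (h : IsSignedPartition (C ++ D)) {I : Item n} (hI : I ∈ symList C D) : I.pts.Nonempty := by
  rcases I with B | _ | _
  · rcases block_mem_symList.1 hI with hB | ⟨B, hB, rfl⟩
    · exact (h.1 B hB).1.image _
    · exact ((h.1 B hB).1.image _).image _
  · exact ⟨_, rfl⟩
  · exact ⟨_, rfl⟩

theorem IsSignedPartition.not_comparable {C D : List (Set (Elt n))}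
    (h : IsSignedPartition (C ++ D)) {I : Item n} (hI : I ∈ symList C D) {c d : Pt n}
    (hc : c ∈ I.pts) (hd : d ∈ I.pts) : ¬ Comparable c d := by
  rcases I with B | _ | _
  · obtain ⟨a, ha, rfl⟩ := hc
    obtain ⟨b, hb, rfl⟩ := hd
    have key : a.IsPos ↔ b.IsPos := by
      rcases block_mem_symList.1 hI with hB | ⟨B, hB, rfl⟩
      · rcases (h.1 B hB).2 with h1 | h1
        · exact iff_of_true (h1 a ha) (h1 b hb)
        · exact iff_of_false (h1 a ha) (h1 b hb)
      · rw [mem_negBlock] at ha hb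
        have h2 := a.isPos_neg
        have h3 := b.isPos_neg
        rcases (h.1 B hB).2 with h1 | h1
        · have := h1 _ ha
          have := h1 _ hb
          tauto
        · have := h1 _ ha
          have := h1 _ hb
          tauto
    rintro ⟨-, h'⟩
    tauto
  · cases hc; cases hd; exact id
  · cases hc; cases hd; exact id

/-! ### Points realizing a pair of lists -/

/-- The point `x` is constant on the blocks, and takes increasing positive values on the blocks
of `C` followed by those of `D`, with `1/2` between the two lists. -/
structure Realizes (x : Fin n → ℝ) (C D : List (Set (Elt n))) : Prop where
  mono : (C ++ D).Pairwise fun B B' => ∀ b ∈ B, ∀ b' ∈ B', b.coord x < b'.coord x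
  const : ∀ B ∈ C ++ D, ∀ b ∈ B, ∀ b' ∈ B, b.coord x = b'.coord x
  pos : ∀ B ∈ C ++ D, ∀ b ∈ B, 0 < b.coord x
  lt_half : ∀ B ∈ C, ∀ b ∈ B, b.coord x < 1 / 2
  half_lt : ∀ B ∈ D, ∀ b ∈ B, 1 / 2 < b.coord x

/-- The elements of a signed partition can be given any positive heights by a point. -/
theorem IsSignedPartition.exists_coord_eq {Bs : List (Set (Elt n))} (h : IsSignedPartition Bs)
    (g : ℕ → ℝ) :
    ∃ x : Fin n → ℝ, ∀ (p : ℕ) (hp : p < Bs.length), ∀ a ∈ Bs[p], a.coord x = g p := by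
  obtain ⟨-, hdisj, hneg, hcov⟩ := isSignedPartition_iff.1 h
  have hex : ∀ i : Fin n, ∃ v : ℝ, (∃ (p : ℕ) (hp : p < Bs.length), .pos i ∈ Bs[p] ∧ v = g p) ∨
      ∃ (p : ℕ) (hp : p < Bs.length), .neg i ∈ Bs[p] ∧ v = -g p := by
    intro i
    obtain ⟨B, hB, ha⟩ := hcov (.pos i)
    obtain ⟨p, hp, rfl⟩ := List.mem_iff_getElem.1 hB
    rcases ha with ha | ha
    · exact ⟨g p, Or.inl ⟨p, hp, ha, rfl⟩⟩
    · exact ⟨-g p, Or.inr ⟨p, hp, ha, rfl⟩⟩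
  have huniq : ∀ (p q : ℕ) (hp : p < Bs.length) (hq : q < Bs.length) (a : Elt n),
      a ∈ Bs[p] → a ∈ Bs[q] → p = q := by
    intro p q hp hq a h1 h2
    rcases lt_trichotomy p q with hpq | hpq | hpq
    · exact absurd h2 (Set.disjoint_left.1 (List.pairwise_iff_getElem.1 hdisj p q hp hq hpq) h1)
    · exact hpq
    · exact absurd h1 (Set.disjoint_left.1 (List.pairwise_iff_getElem.1 hdisj q p hq hp hpq) h2)
  choose x hx using hex
  refine ⟨x, fun p hp a ha => ?_⟩
  rcases a with i | i
  · rcases hx i with ⟨q, hq, hm, hv⟩ | ⟨q, hq, hm, -⟩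
    · rw [huniq p q hp hq _ ha hm]
      exact hv
    · exact absurd hm (hneg _ (List.getElem_mem hp) _ (List.getElem_mem hq) _ ha)
  · rcases hx i with ⟨q, hq, hm, -⟩ | ⟨q, hq, hm, hv⟩
    · exact absurd hm (hneg _ (List.getElem_mem hp) _ (List.getElem_mem hq) _ ha)
    · rw [huniq p q hp hq _ ha hm]
      simp only [Elt.coord, hv, neg_neg]

theorem IsSignedPartition.exists_realizes {C D : List (Set (Elt n))}
    (h : IsSignedPartition (C ++ D)) : ∃ x, Realizes x C D := by
  set l := C.length with hl
  set g : ℕ → ℝ := fun p => if p < l then (p + 1) / (2 * (l + 1)) else p + 1 with hg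
  have hlow : ∀ p, p < l → g p = (p + 1) / (2 * (l + 1)) := fun p hp => by simp [hg, hp]
  have hhigh : ∀ p, l ≤ p → g p = p + 1 := fun p hp => by simp [hg, hp.not_gt]
  have hl0 : (0 : ℝ) < 2 * (l + 1) := by positivity
  have hlow' : ∀ p, p < l → g p < 1 / 2 := fun p hp => by
    rw [hlow p hp, div_lt_iff₀ hl0]
    have : (p : ℝ) < l := by exact_mod_cast hp
    linarith
  have hhigh' : ∀ p, l ≤ p → 1 / 2 < g p := fun p hp => by
    rw [hhigh p hp]
    have : (0 : ℝ) ≤ p := p.cast_nonneg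
    linarith
  have hpos : ∀ p, 0 < g p := fun p => by
    simp only [hg]
    split_ifs <;> positivity
  have hmono : StrictMono g := by
    intro p q hpq
    have hpq' : (p : ℝ) < q := by exact_mod_cast hpq
    rcases lt_or_ge q l with hq | hq
    · rw [hlow p (hpq.trans hq), hlow q hq]
      gcongr
    rcases lt_or_ge p l with hp | hp
    · exact (hlow' p hp).trans (hhigh' q hq)
    · rw [hhigh p hp, hhigh q hq]
      linarith
  obtain ⟨x, hx⟩ := h.exists_coord_eq g
  refine ⟨x, ?_, ?_, ?_, ?_, ?_⟩
  · refine List.pairwise_iff_getElem.2 fun p q hp hq hpq b hb b' hb' => ?_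
    rw [hx p hp b hb, hx q hq b' hb']
    exact hmono hpq
  · intro B hB b hb b' hb'
    obtain ⟨p, hp, rfl⟩ := List.mem_iff_getElem.1 hB
    rw [hx p hp b hb, hx p hp b' hb']
  · intro B hB b hb
    obtain ⟨p, hp, rfl⟩ := List.mem_iff_getElem.1 hB
    rw [hx p hp b hb]
    exact hpos p
  · intro B hB b hb
    obtain ⟨p, hp, rfl⟩ := List.mem_iff_getElem.1 hB
    rw [hx p (by simp; omega) b (by rwa [List.getElem_append_left hp])]
    exact hlow' p hp
  · intro B hB b hb
    obtain ⟨p, hp, rfl⟩ := List.mem_iff_getElem.1 hB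
    rw [hx (l + p) (by simp; omega) b (by simpa [hl] using hb)]
    exact hhigh' _ (by omega)

namespace Realizes

variable {x : Fin n → ℝ} {C D : List (Set (Elt n))}

theorem pairwise (hx : Realizes x C D) :
    (symList C D).Pairwise fun I J => ∀ c ∈ I.pts, ∀ d ∈ J.pts, c.val x < d.val x := by
  obtain ⟨hC, hD, hCD⟩ := List.pairwise_append.1 hx.mono
  refine pairwise_symList ?_ (pairwise_upperList hC hD hCD hx.lt_half hx.half_lt) ?_
  · intro c d h
    rw [Pt.val_reflect, Pt.val_reflect] at h
    linarith
  · have key : ∀ I ∈ upperList C D, ∀ c ∈ I.pts, 0 < c.val x := by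
      intro I hI c hc
      rcases exists_of_mem_upperList hI hc with rfl | ⟨B, hB, b, hb, rfl⟩
      · norm_num [Pt.val]
      · exact hx.pos B hB b hb
    intro I hI J hJ c hc d hd
    rw [Pt.val_reflect]
    linarith [key I hI c hc, key J hJ d hd]

theorem val_eq (hx : Realizes x C D) {I : Item n} (hI : I ∈ symList C D) {c d : Pt n}
    (hc : c ∈ I.pts) (hd : d ∈ I.pts) : c.val x = d.val x := by
  rcases I with B | _ | _
  · obtain ⟨a, ha, rfl⟩ := hc
    obtain ⟨b, hb, rfl⟩ := hd
    rcases block_mem_symList.1 hI with hB | ⟨B, hB, rfl⟩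
    · exact hx.const B hB a ha b hb
    · have := hx.const B hB _ (mem_negBlock.1 ha) _ (mem_negBlock.1 hb)
      rw [Elt.coord_neg, Elt.coord_neg] at this
      exact neg_injective this
  · cases hc; cases hd; rfl
  · cases hc; cases hd; rfl

theorem eq_of_val_eq (hx : Realizes x C D) {I J : Item n} (hI : I ∈ symList C D)
    (hJ : J ∈ symList C D) {c d : Pt n} (hc : c ∈ I.pts) (hd : d ∈ J.pts)
    (h : c.val x = d.val x) : I = J := by
  by_contra hne
  have hsymm : (symList C D).Pairwise fun I J => ∀ c ∈ I.pts, ∀ d ∈ J.pts, c.val x ≠ d.val x :=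
    hx.pairwise.imp fun hIJ c hc d hd => (hIJ c hc d hd).ne
  have : Std.Symm fun I J : Item n => ∀ c ∈ I.pts, ∀ d ∈ J.pts, c.val x ≠ d.val x :=
    ⟨fun I J hIJ c hc d hd => (hIJ d hd c hc).symm⟩
  exact hsymm.forall hI hJ hne c hc d hd h

theorem eq_levelItem (hx : Realizes x C D) (hp : IsSignedPartition (C ++ D)) {I : Item n}
    (hI : I ∈ symList C D) {c : Pt n} (hc : c ∈ I.pts) : I = levelItem x c := by
  rcases I with B | _ | _
  · obtain ⟨b, hb, rfl⟩ := hc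
    simp only [levelItem, Item.block.injEq]
    ext a
    refine ⟨fun ha => hx.val_eq hI (c := .elt a) (d := .elt b) ⟨a, ha, rfl⟩ ⟨b, hb, rfl⟩,
      fun ha => ?_⟩
    obtain ⟨J, hJ, haJ⟩ := hp.exists_mem_symList (.elt a)
    have hIJ := hx.eq_of_val_eq hI hJ (c := .elt b) (d := .elt a) ⟨b, hb, rfl⟩ haJ ha.symm
    subst hIJ
    obtain ⟨a', ha', h⟩ := haJ
    cases h
    exact ha'
  · cases hc; rfl
  · cases hc; rfl

theorem ofList_eq_levelOrder (hx : Realizes x C D) (hp : IsSignedPartition (C ++ D)) :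
    ofList (symList C D) = levelOrder x := by
  have hmem : ∀ c, levelItem x c ∈ symList C D ∧ c ∈ (levelItem x c).pts := by
    intro c
    obtain ⟨I, hI, hc⟩ := hp.exists_mem_symList c
    rw [← hx.eq_levelItem hp hI hc]
    exact ⟨hI, hc⟩
  ext I J
  · constructor
    · intro hI
      obtain ⟨c, hc⟩ := hp.nonempty_pts hI
      exact ⟨c, (hx.eq_levelItem hp hI hc).symm⟩
    · rintro ⟨c, rfl⟩
      exact (hmem c).1
  · constructor
    · rintro ⟨p, q, hpq, rfl, rfl⟩
      have hp' := List.get_mem (symList C D) p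
      have hq' := List.get_mem (symList C D) q
      obtain ⟨c, hc⟩ := hp.nonempty_pts hp'
      obtain ⟨d, hd⟩ := hp.nonempty_pts hq'
      exact ⟨c, d, hx.eq_levelItem hp hp' hc, hx.eq_levelItem hp hq' hd,
        List.pairwise_iff_get.1 hx.pairwise p q hpq c hc d hd⟩
    · rintro ⟨c, d, rfl, rfl, h⟩
      obtain ⟨hc, hcm⟩ := hmem c
      obtain ⟨hd, hdm⟩ := hmem d
      obtain ⟨p, hp'⟩ := List.mem_iff_get.1 hc
      obtain ⟨q, hq'⟩ := List.mem_iff_get.1 hd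
      refine ⟨p, q, ?_, hp', hq'⟩
      rcases lt_trichotomy p q with hpq | rfl | hpq
      · exact hpq
      · rw [val_eq_of_levelItem_eq (hp'.symm.trans hq')] at h
        exact absurd h (lt_irrefl _)
      · have := List.pairwise_iff_get.1 hx.pairwise q p hpq d (hq' ▸ hdm) c (hp' ▸ hcm)
        exact absurd h this.not_gt

/-- If the separated pairs are ordered by `x` as they are displayed by `symList C D`, then `x`
lies in the same cell as any point realizing `C` and `D`. -/
theorem cell_eq {y : Fin n → ℝ} (hy : Realizes y C D) (hp : IsSignedPartition (C ++ D))
    (hx : Generic x)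
    (h : (symList C D).Pairwise fun I J =>
      ∀ c ∈ I.pts, ∀ d ∈ J.pts, Comparable c d → c.val x < d.val x) :
    cell x = cell y := by
  have hmem : y ∈ cell x := by
    intro c d hcd hlt
    obtain ⟨I, hI, hc⟩ := hp.exists_mem_symList c
    obtain ⟨J, hJ, hd⟩ := hp.exists_mem_symList d
    have hne : I ≠ J := by
      rintro rfl
      exact hp.not_comparable hI hc hd hcd
    by_contra hnot
    have hboth : (symList C D).Pairwise fun I J => ∀ c ∈ I.pts, ∀ d ∈ J.pts, Comparable c d →
        (c.val x < d.val x ∧ c.val y < d.val y ∨ d.val x < c.val x ∧ d.val y < c.val y) :=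
      (h.and hy.pairwise).imp fun hIJ c hc d hd hcd =>
        Or.inl ⟨hIJ.1 c hc d hd hcd, hIJ.2 c hc d hd⟩
    have : Std.Symm fun I J : Item n => ∀ c ∈ I.pts, ∀ d ∈ J.pts, Comparable c d →
        (c.val x < d.val x ∧ c.val y < d.val y ∨ d.val x < c.val x ∧ d.val y < c.val y) :=
      ⟨fun I J hIJ c hc d hd hcd => (hIJ d hd c hc hcd.symm).symm⟩
    rcases hboth.forall hI hJ hne c hc d hd hcd with h1 | h1
    · exact hnot h1.2
    · exact h1.1.not_gt hlt
  exact (cell_eq_of_mem hx hmem).symm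

theorem mem_of_pos (hx : Realizes x C D) (hp : IsSignedPartition (C ++ D)) {a : Elt n}
    (ha : 0 < a.coord x) : ∃ B ∈ C ++ D, a ∈ B := by
  obtain ⟨B, hB, h | h⟩ := (isSignedPartition_iff.1 hp).2.2.2 a
  · exact ⟨B, hB, h⟩
  · have := hx.pos B hB _ h
    rw [Elt.coord_neg] at this
    linarith

theorem mem_of_lt_half (hx : Realizes x C D) (hp : IsSignedPartition (C ++ D)) {a : Elt n}
    (ha : 0 < a.coord x) (ha' : a.coord x < 1 / 2) : ∃ B ∈ C, a ∈ B := by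
  obtain ⟨B, hB, h⟩ := hx.mem_of_pos hp ha
  rcases List.mem_append.1 hB with hB | hB
  · exact ⟨B, hB, h⟩
  · exact absurd (hx.half_lt B hB a h) ha'.not_gt

theorem mem_of_half_lt (hx : Realizes x C D) (hp : IsSignedPartition (C ++ D)) {a : Elt n}
    (ha : 1 / 2 < a.coord x) : ∃ B ∈ D, a ∈ B := by
  obtain ⟨B, hB, h⟩ := hx.mem_of_pos hp (by linarith)
  rcases List.mem_append.1 hB with hB | hB
  · exact absurd (hx.lt_half B hB a h) ha.not_gt
  · exact ⟨B, hB, h⟩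

/-- In a chain of blocks of alternating signs, a block of the opposite sign lies between any two
blocks of the same sign. -/
theorem exists_between {L : List (Set (Elt n))} (hL : L.IsChain OppSign)
    (hne : ∀ B ∈ L, B.Nonempty)
    (hmono : L.Pairwise fun B B' => ∀ b ∈ B, ∀ b' ∈ B', b.coord x < b'.coord x)
    (hconst : ∀ B ∈ L, ∀ b ∈ B, ∀ b' ∈ B, b.coord x = b'.coord x) {a b : Elt n}
    {B B' : Set (Elt n)} (hB : B ∈ L) (hB' : B' ∈ L) (ha : a ∈ B) (hb : b ∈ B')
    (hs : a.IsPos ↔ b.IsPos) (hlt : a.coord x < b.coord x) :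
    ∃ c : Elt n, (c.IsPos ↔ ¬ a.IsPos) ∧ a.coord x < c.coord x ∧ c.coord x < b.coord x := by
  obtain ⟨p, hp, rfl⟩ := List.mem_iff_getElem.1 hB
  obtain ⟨q, hq, rfl⟩ := List.mem_iff_getElem.1 hB'
  rw [List.pairwise_iff_getElem] at hmono
  have hpq : p < q := by
    rcases lt_trichotomy p q with h | rfl | h
    · exact h
    · exact absurd (hconst _ hB a ha b hb) hlt.ne
    · exact absurd (hmono q p hq hp h b hb a ha) hlt.not_gt
  have hopp : OppSign L[p] L[p + 1] := List.isChain_iff_getElem.1 hL p (by omega)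
  have hsgn : ∀ c ∈ L[p + 1], (c.IsPos ↔ ¬ a.IsPos) := by
    intro c hc
    rcases hopp with ⟨h1, h2⟩ | ⟨h1, h2⟩
    · have := h1 a ha
      have := h2 c hc
      tauto
    · have := h1 a ha
      have := h2 c hc
      tauto
  have hne' : p + 1 ≠ q := by
    rintro rfl
    have := hsgn b hb
    tauto
  obtain ⟨c, hc⟩ := hne _ (List.getElem_mem (show p + 1 < L.length by omega))
  exact ⟨c, hsgn c hc, hmono p (p + 1) hp (by omega) (by omega) a ha c hc,
    hmono (p + 1) q (by omega) hq (by omega) c hc b hb⟩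

theorem isLayered (hx : Realizes x C D) (h : IsAdmissible C D) : IsLayered x := by
  obtain ⟨hp, hC, hD, hmid⟩ := h
  obtain ⟨hmC, hmD, -⟩ := List.pairwise_append.1 hx.mono
  have hsign : ∀ a b : Elt n, a.coord x = b.coord x → (a.IsPos ↔ b.IsPos) := by
    intro a b hab
    obtain ⟨I, hI, ha⟩ := hp.exists_mem_symList (.elt a)
    obtain ⟨J, hJ, hb⟩ := hp.exists_mem_symList (.elt b)
    obtain rfl := hx.eq_of_val_eq hI hJ ha hb hab
    have hnc := hp.not_comparable hI ha hb
    by_contra hs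
    refine hnc ⟨?_, by tauto⟩
    rintro rfl
    obtain ⟨B, hB, h | h⟩ := (isSignedPartition_iff.1 hp).2.2.2 a <;>
      · have := hx.pos B hB _ h
        rw [Elt.coord_neg] at *
        linarith
  have hgen : Generic x := by
    intro c d hcd hv
    obtain ⟨I, hI, hc⟩ := hp.exists_mem_symList c
    obtain ⟨J, hJ, hd⟩ := hp.exists_mem_symList d
    obtain rfl := hx.eq_of_val_eq hI hJ hc hd hv
    exact hp.not_comparable hI hc hd hcd
  refine ⟨hgen, hsign, ?_, ?_⟩
  · rintro a b ha hab hs (hb | ha')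
    · obtain ⟨B, hB, haB⟩ := hx.mem_of_lt_half hp ha (hab.trans hb)
      obtain ⟨B', hB', hbB⟩ := hx.mem_of_lt_half hp (ha.trans hab) hb
      exact exists_between hC (fun B hB => (hp.1 B (by simp [hB])).1) hmC
        (fun B hB => hx.const B (by simp [hB])) hB hB' haB hbB hs hab
    · obtain ⟨B, hB, haB⟩ := hx.mem_of_half_lt hp ha'
      obtain ⟨B', hB', hbB⟩ := hx.mem_of_half_lt hp (ha'.trans hab)
      exact exists_between hD (fun B hB => (hp.1 B (by simp [hB])).1) hmD
        (fun B hB => hx.const B (by simp [hB])) hB hB' haB hbB hs hab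
  · rcases hmid with rfl | ⟨B₁, C', rfl, hcard⟩ | ⟨B₁, B₂, D', rfl, rfl, hcard, hs⟩
    · left
      intro a ha
      obtain ⟨B, hB, haB⟩ := hx.mem_of_pos hp ha
      exact hx.half_lt B hB a haB
    · right; left
      obtain ⟨a, ha, b, hb, hab⟩ := (Set.one_lt_ncard (Set.toFinite _)).1 hcard
      refine ⟨a, b, hab, hx.const B₁ (by simp) a ha b hb, hx.pos B₁ (by simp) a ha,
        hx.lt_half B₁ (by simp) a ha, fun c hc => ?_⟩
      obtain ⟨B, hB, hcB⟩ := hx.mem_of_pos hp hc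
      rw [List.cons_append, List.mem_cons] at hB
      rcases hB with rfl | hB
      · exact (hx.const B (by simp) a ha c hcB).le
      · exact ((List.pairwise_cons.1 hx.mono).1 B hB a ha c hcB).le
    · right; right
      obtain ⟨a, rfl⟩ := Set.ncard_eq_one.1 hcard
      obtain ⟨e, he⟩ := (hp.1 B₂ (by simp)).1
      refine ⟨a, e, hx.pos {a} (by simp) a rfl, hx.lt_half {a} (by simp) a rfl, fun c hc hc' => ?_,
        ?_, hx.half_lt B₂ (by simp) e he, fun d hd => ?_⟩
      · obtain ⟨B, hB, hcB⟩ := hx.mem_of_lt_half hp hc hc'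
        rw [List.mem_singleton] at hB
        subst hB
        exact hcB
      · rcases hs with ⟨h1, h2⟩ | ⟨h1, h2⟩
        · exact iff_of_true (h1 a rfl) (h2 e he)
        · exact iff_of_false (h1 a rfl) (h2 e he)
      · obtain ⟨B, hB, hdB⟩ := hx.mem_of_half_lt hp hd
        rcases List.mem_cons.1 hB with rfl | hB
        · exact (hx.const B (by simp) e he d hdB).le
        · exact ((List.pairwise_cons.1 hmD).1 B hB e he d hdB).le

/-- The order associated to the region of a point realizing admissible lists is the order
displayed by these lists. -/
theorem regionOrder_cell (hx : Realizes x C D) (h : IsAdmissible C D) :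
    regionOrder (cell x) = ofList (symList C D) := by
  rw [(hx.isLayered h).regionOrder_cell, hx.ofList_eq_levelOrder h.1]

end Realizes

/-! ### Every region contains a point realizing admissible lists -/

theorem OppSign.insert {B B' : Set (Elt n)} (h : OppSign B B') {a e : Elt n} (he : e ∈ B)
    (hs : a.IsPos ↔ e.IsPos) : OppSign (insert a B) B' := by
  rcases h with ⟨h1, h2⟩ | ⟨h1, h2⟩
  · exact Or.inl ⟨Set.forall_mem_insert.2 ⟨hs.2 (h1 e he), h1⟩, h2⟩
  · exact Or.inr ⟨Set.forall_mem_insert.2 ⟨fun h => h1 e he (hs.1 h), h1⟩, h2⟩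

theorem signed_insert {B : Set (Elt n)} (h : IsPosBlock B ∨ IsNegBlock B) {a e : Elt n}
    (he : e ∈ B) (hs : a.IsPos ↔ e.IsPos) :
    IsPosBlock (insert a B) ∨ IsNegBlock (insert a B) := by
  rcases h with h1 | h1
  · exact Or.inl (Set.forall_mem_insert.2 ⟨hs.2 (h1 e he), h1⟩)
  · exact Or.inr (Set.forall_mem_insert.2 ⟨fun h => h1 e he (hs.1 h), h1⟩)

theorem signed_singleton (a : Elt n) : IsPosBlock {a} ∨ IsNegBlock {a} := by
  by_cases h : a.IsPos
  · exact Or.inl (by rintro _ rfl; exact h)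
  · exact Or.inr (by rintro _ rfl; exact h)

theorem isChain_oppSign_insert {B : Set (Elt n)} {L : List (Set (Elt n))}
    (h : (B :: L).IsChain OppSign) {a e : Elt n} (he : e ∈ B) (hs : a.IsPos ↔ e.IsPos) :
    (insert a B :: L).IsChain OppSign := by
  cases L with
  | nil => exact .singleton _
  | cons B' L =>
    rw [List.isChain_cons_cons] at h ⊢
    exact ⟨h.1.insert he hs, h.2⟩

/-- The list `L` consists of non-empty disjoint blocks with union `S` and alternating signs, and
elements of opposite signs are ordered by `x` as their blocks are in `L`. -/
structure IsRunList (x : Fin n → ℝ) (S : Set (Elt n)) (L : List (Set (Elt n))) : Prop where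
  signed : ∀ B ∈ L, B.Nonempty ∧ (IsPosBlock B ∨ IsNegBlock B)
  disjoint : L.Pairwise Disjoint
  mem_iff : ∀ a, (∃ B ∈ L, a ∈ B) ↔ a ∈ S
  chain : L.IsChain OppSign
  mono : L.Pairwise fun B B' => ∀ b ∈ B, ∀ b' ∈ B', (b.IsPos ↔ ¬ b'.IsPos) →
    b.coord x < b'.coord x

/-- A run list of `S` extends by a new minimal element of the sign of its first block. -/
theorem IsRunList.insert_head {x : Fin n → ℝ} {S : Set (Elt n)} {B : Set (Elt n)}
    {L : List (Set (Elt n))} (h : IsRunList x S (B :: L)) {a e : Elt n} (ha : a ∉ S)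
    (he : e ∈ B) (hs : a.IsPos ↔ e.IsPos)
    (hlt : ∀ b ∈ S, (a.IsPos ↔ ¬ b.IsPos) → a.coord x < b.coord x) :
    IsRunList x (insert a S) (insert a B :: L) := by
  have hmem : ∀ B' ∈ L, ∀ b ∈ B', b ∈ S := fun B' hB' b hb =>
    (h.mem_iff b).1 ⟨B', List.mem_cons_of_mem _ hB', hb⟩
  obtain ⟨hd1, hd2⟩ := List.pairwise_cons.1 h.disjoint
  obtain ⟨hm1, hm2⟩ := List.pairwise_cons.1 h.mono
  refine ⟨?_, ?_, ?_, isChain_oppSign_insert h.chain he hs, ?_⟩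
  · refine List.forall_mem_cons.2 ⟨⟨Set.insert_nonempty _ _, ?_⟩,
      fun B' hB' => h.signed B' (List.mem_cons_of_mem _ hB')⟩
    exact signed_insert (h.signed B (by simp)).2 he hs
  · refine List.pairwise_cons.2 ⟨fun B' hB' => ?_, hd2⟩
    rw [Set.disjoint_insert_left]
    exact ⟨fun h' => ha (hmem B' hB' a h'), hd1 B' hB'⟩
  · intro b
    have := h.mem_iff b
    simp only [List.mem_cons, exists_eq_or_imp] at this ⊢
    rw [Set.mem_insert_iff, Set.mem_insert_iff, ← this, or_assoc]
  · refine List.pairwise_cons.2 ⟨fun B' hB' b hb b' hb' hbb' => ?_, hm2⟩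
    rcases Set.mem_insert_iff.1 hb with rfl | hb
    · exact hlt b' (hmem B' hB' b' hb') hbb'
    · exact hm1 B' hB' b hb b' hb' hbb'

/-- A run list of `S` extends by a new minimal element whose sign is not that of its first
block. -/
theorem IsRunList.cons_singleton {x : Fin n → ℝ} {S : Set (Elt n)} {L : List (Set (Elt n))}
    (h : IsRunList x S L) {a : Elt n} (ha : a ∉ S)
    (hs : ∀ B L', L = B :: L' → ∃ e ∈ B, ¬ (a.IsPos ↔ e.IsPos))
    (hlt : ∀ b ∈ S, (a.IsPos ↔ ¬ b.IsPos) → a.coord x < b.coord x) :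
    IsRunList x (insert a S) ({a} :: L) := by
  have hmem : ∀ B' ∈ L, ∀ b ∈ B', b ∈ S := fun B' hB' b hb => (h.mem_iff b).1 ⟨B', hB', hb⟩
  refine ⟨List.forall_mem_cons.2 ⟨⟨⟨a, rfl⟩, signed_singleton a⟩, h.signed⟩,
    List.pairwise_cons.2 ⟨fun B' hB' => ?_, h.disjoint⟩, fun b => ?_, ?_,
    List.pairwise_cons.2 ⟨?_, h.mono⟩⟩
  · rw [Set.disjoint_singleton_left]
    exact fun h' => ha (hmem B' hB' a h')
  · simp only [List.mem_cons, exists_eq_or_imp, h.mem_iff]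
    rfl
  · cases L with
    | nil => exact .singleton _
    | cons B L =>
      rw [List.isChain_cons_cons]
      refine ⟨?_, h.chain⟩
      obtain ⟨e, he, hae⟩ := hs B L rfl
      rcases (h.signed B (by simp)).2 with h1 | h1
      · exact Or.inr ⟨by rintro _ rfl h'; exact hae (iff_of_true h' (h1 e he)), h1⟩
      · refine Or.inl ⟨?_, h1⟩
        rintro _ rfl
        by_contra h'
        exact hae (iff_of_false h' (h1 e he))
  · rintro B' hB' _ rfl b' hb' hbb'
    exact hlt b' (hmem B' hB' b' hb') hbb'

/-- A set of elements of `N` is cut into the runs of equal sign in the order of their values. -/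
theorem exists_isRunList (x : Fin n → ℝ) (S : Set (Elt n))
    (hS : ∀ a ∈ S, ∀ b ∈ S, (a.IsPos ↔ ¬ b.IsPos) → a.coord x ≠ b.coord x) :
    ∃ L, IsRunList x S L := by
  classical
  lift S to Finset (Elt n) using S.toFinite
  induction S using Finset.induction_on_min_value (fun a : Elt n => a.coord x) with
  | empty => exact ⟨[], by simp, .nil, by simp, .nil, .nil⟩
  | insert a S ha hmin ih =>
    obtain ⟨L, hL⟩ := ih fun b hb c hc => hS b (by simp_all) c (by simp_all)
    have hlt : ∀ b ∈ (S : Set (Elt n)), (a.IsPos ↔ ¬ b.IsPos) → a.coord x < b.coord x :=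
      fun b hb hs => lt_of_le_of_ne (hmin b hb) (hS a (by simp) b (by simp_all) hs)
    rw [Finset.coe_insert]
    by_cases hs : ∀ B L', L = B :: L' → ∃ e ∈ B, ¬ (a.IsPos ↔ e.IsPos)
    · exact ⟨_, hL.cons_singleton ha hs hlt⟩
    · push Not at hs
      obtain ⟨B, L', rfl, hB⟩ := hs
      obtain ⟨e, he⟩ := (hL.signed B (by simp)).1
      exact ⟨_, hL.insert_head ha he (hB e he) hlt⟩

/-- Disjoint signed blocks form a signed partition as soon as their union contains exactly one
of `a` and `-a` for every `a`. -/
theorem isSignedPartition_of_mem_iff {Bs : List (Set (Elt n))} {U : Set (Elt n)}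
    (h1 : ∀ B ∈ Bs, B.Nonempty ∧ (IsPosBlock B ∨ IsNegBlock B)) (h2 : Bs.Pairwise Disjoint)
    (h3 : ∀ a, (∃ B ∈ Bs, a ∈ B) ↔ a ∈ U) (hU : ∀ a, a ∈ U ↔ -a ∉ U) : IsSignedPartition Bs := by
  refine isSignedPartition_iff.2 ⟨h1, h2, fun B hB B' hB' a ha ha' => ?_, fun a => ?_⟩
  · exact (hU a).1 ((h3 a).1 ⟨B, hB, ha⟩) ((h3 _).1 ⟨B', hB', ha'⟩)
  · by_cases ha : a ∈ U
    · obtain ⟨B, hB, ha⟩ := (h3 a).2 ha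
      exact ⟨B, hB, Or.inl ha⟩
    · have : -a ∈ U := by
        by_contra h
        exact ha ((hU a).2 h)
      obtain ⟨B, hB, ha⟩ := (h3 _).2 this
      exact ⟨B, hB, Or.inr ha⟩

theorem pairwise_symList_of_isRunList {x : Fin n → ℝ} {S T : Set (Elt n)}
    {C D : List (Set (Elt n))} (hC : IsRunList x S C) (hD : IsRunList x T D)
    (hS : ∀ a ∈ S, -(1 / 2) < a.coord x ∧ a.coord x < 1 / 2) (hT : ∀ a ∈ T, 1 / 2 < a.coord x)
    (hsum : ∀ a ∈ S, ∀ b ∈ S, a ≠ b → (a.IsPos ↔ b.IsPos) → 0 < a.coord x + b.coord x) :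
    (symList C D).Pairwise fun I J =>
      ∀ c ∈ I.pts, ∀ d ∈ J.pts, Comparable c d → c.val x < d.val x := by
  have hCS : ∀ B ∈ C, ∀ b ∈ B, b ∈ S := fun B hB b hb => (hC.mem_iff b).1 ⟨B, hB, hb⟩
  have hDT : ∀ B ∈ D, ∀ b ∈ B, b ∈ T := fun B hB b hb => (hD.mem_iff b).1 ⟨B, hB, hb⟩
  refine pairwise_symList (Q := fun c d => Comparable c d → c.val x < d.val x) ?_
    (pairwise_upperList ?_ ?_ ?_ ?_ ?_) ?_
  · intro c d h hcd
    have := h hcd.symm.reflect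
    rw [Pt.val_reflect, Pt.val_reflect] at this
    linarith
  · exact hC.mono.imp fun h b hb b' hb' hbb' => h b hb b' hb' hbb'.2
  · exact hD.mono.imp fun h b hb b' hb' hbb' => h b hb b' hb' hbb'.2
  · intro B hB B' hB' b hb b' hb' _
    exact (hS b (hCS B hB b hb)).2.trans (hT b' (hDT B' hB' b' hb'))
  · exact fun B hB b hb _ => (hS b (hCS B hB b hb)).2
  · exact fun B hB b hb _ => hT b (hDT B hB b hb)
  · have key : ∀ B ∈ C ++ D, ∀ b ∈ B, b ∈ S ∨ b ∈ T := by
      intro B hB b hb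
      rcases List.mem_append.1 hB with hB | hB
      · exact Or.inl (hCS B hB b hb)
      · exact Or.inr (hDT B hB b hb)
    have key' : ∀ b, b ∈ S ∨ b ∈ T → -(1 / 2) < b.coord x := by
      rintro b (hb | hb)
      · exact (hS b hb).1
      · linarith [hT b hb]
    intro I hI J hJ c hc d hd hcd
    rw [Pt.val_reflect]
    rcases exists_of_mem_upperList hI hc with rfl | ⟨B, hB, a, ha, rfl⟩ <;>
      rcases exists_of_mem_upperList hJ hd with rfl | ⟨B', hB', b, hb, rfl⟩
    · exact hcd.elim
    · exact key' b (key B' hB' b hb)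
    · have := key' a (key B hB a ha)
      simp only [Pt.val]
      linarith
    · have hba : b ≠ a := by simpa using hcd.1
      have hs : a.IsPos ↔ b.IsPos := by
        have h1 := hcd.2
        have h2 := a.isPos_neg
        tauto
      have ha' := key B hB a ha
      have hb' := key B' hB' b hb
      simp only [Pt.val]
      have ha'' := key' a ha'
      have hb'' := key' b hb'
      rcases ha' with ha' | ha'
      · rcases hb' with hb' | hb'
        · linarith [hsum a ha' b hb' hba.symm hs]
        · linarith [hT b hb']
      · linarith [hT a ha']

theorem Generic.coord_ne_of_opp {x : Fin n → ℝ} (hx : Generic x) {a b : Elt n} (hba : b ≠ -a)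
    (hs : a.IsPos ↔ ¬ b.IsPos) : a.coord x ≠ b.coord x :=
  hx (.elt a) (.elt b) ⟨hba, hs⟩

theorem Generic.coord_add_ne_zero {x : Fin n → ℝ} (hx : Generic x) {a b : Elt n} (hba : a ≠ b)
    (hs : a.IsPos ↔ b.IsPos) : a.coord x + b.coord x ≠ 0 := by
  have hb := b.isPos_neg
  have := hx.coord_ne_of_opp (a := a) (b := -b) (fun h => hba (neg_injective h).symm) (by tauto)
  rw [Elt.coord_neg] at this
  exact fun h => this (by linarith)

theorem Generic.exists_isRunList_of_pos {x : Fin n → ℝ} (hx : Generic x) {S : Set (Elt n)}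
    (hS : ∀ a ∈ S, 0 < a.coord x) : ∃ L, IsRunList x S L := by
  refine exists_isRunList x S fun a ha b hb hs => hx.coord_ne_of_opp ?_ hs
  rintro rfl
  have h1 := hS a ha
  have h2 := hS _ hb
  rw [Elt.coord_neg] at h2
  linarith

/-- An element of `N` of smallest absolute value, when this value is less than `1/2`. The last
condition says that all other values are non-zero. -/
def IsCentral (x : Fin n → ℝ) (a : Elt n) : Prop :=
  |a.coord x| < 1 / 2 ∧ ∀ b, b ≠ a → b ≠ -a → |a.coord x| ≤ |b.coord x| ∧ b.coord x ≠ 0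

theorem IsCentral.neg {x : Fin n → ℝ} {a : Elt n} (h : IsCentral x a) : IsCentral x (-a) := by
  rw [IsCentral, Elt.coord_neg, abs_neg, neg_neg]
  exact ⟨h.1, fun b h1 h2 => h.2 b h2 h1⟩

theorem Generic.exists_isCentral {x : Fin n → ℝ} (hx : Generic x)
    (h : ∃ a : Elt n, |a.coord x| < 1 / 2) : ∃ a, IsCentral x a := by
  obtain ⟨a₀, h₀⟩ := h
  have : Nonempty (Elt n) := ⟨a₀⟩
  obtain ⟨a, ha⟩ := Finite.exists_min fun a : Elt n => |a.coord x|
  refine ⟨a, (ha a₀).trans_lt h₀, fun b hba hba' => ⟨ha b, fun h0 => ?_⟩⟩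
  have ha0 : a.coord x = 0 := by
    have := ha b
    rw [h0, abs_zero] at this
    exact abs_nonpos_iff.1 this
  by_cases hs : a.IsPos ↔ b.IsPos
  · exact hx.coord_add_ne_zero hba.symm hs (by rw [ha0, h0, add_zero])
  · exact hx.coord_ne_of_opp hba' (by tauto) (ha0.trans h0.symm)

/-- The elements with values in `(0, 1/2)`, apart from `a` and `-a`. -/
def middleSet (x : Fin n → ℝ) (a : Elt n) : Set (Elt n) :=
  {b | b ≠ a ∧ b ≠ -a ∧ 0 < b.coord x ∧ b.coord x < 1 / 2}

theorem middleSet_neg (x : Fin n → ℝ) (a : Elt n) : middleSet x (-a) = middleSet x a := by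
  ext b
  simp only [middleSet, Set.mem_ofPred_eq, neg_neg]
  tauto

theorem IsCentral.exists_isPos_iff {x : Fin n → ℝ} {a : Elt n} (h : IsCentral x a) (p : Prop) :
    ∃ a', IsCentral x a' ∧ middleSet x a' = middleSet x a ∧ (a'.IsPos ↔ p) := by
  by_cases hp : a.IsPos ↔ p
  · exact ⟨a, h, rfl, hp⟩
  · refine ⟨-a, h.neg, middleSet_neg x a, ?_⟩
    rw [Elt.isPos_neg]
    tauto

theorem exists_admissible_pairwise (hn : n ≠ 1) {x : Fin n → ℝ} (hx : Generic x) :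
    ∃ C D, IsAdmissible C D ∧ (symList C D).Pairwise fun I J =>
      ∀ c ∈ I.pts, ∀ d ∈ J.pts, Comparable c d → c.val x < d.val x := by
  set T : Set (Elt n) := {a | 1 / 2 < a.coord x} with hT
  obtain ⟨D, hD⟩ := hx.exists_isRunList_of_pos (S := T) fun a ha =>
    one_half_pos.trans ha
  by_cases hmid : ∃ a : Elt n, |a.coord x| < 1 / 2
  swap
  · push Not at hmid
    have hnil : IsRunList x ∅ [] := ⟨by simp, .nil, by simp, .nil, .nil⟩
    refine ⟨[], D, ⟨?_, .nil, hD.chain, Or.inl rfl⟩,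
      pairwise_symList_of_isRunList hnil hD (by simp) (fun a ha => ha) (by simp)⟩
    refine isSignedPartition_of_mem_iff (U := T) hD.signed hD.disjoint hD.mem_iff fun a => ?_
    simp only [hT, Set.mem_ofPred_eq, Elt.coord_neg, not_lt]
    obtain ⟨h1, h2⟩ := hx.coord_ne a
    rcases le_abs.1 (hmid a) with h | h
    · exact iff_of_true (lt_of_le_of_ne h h1.symm) (by linarith)
    · refine iff_of_false (by linarith) ?_
      have := lt_of_le_of_ne h (fun h => h2 (by linarith))
      linarith
  obtain ⟨a₀, ha₀⟩ := hx.exists_isCentral hmid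
  obtain ⟨C, hC⟩ := hx.exists_isRunList_of_pos (S := middleSet x a₀) fun a ha => ha.2.2.1
  -- A central element `a`, whose sign is chosen below, is added to the runs.
  have hfacts : ∀ a, IsCentral x a → middleSet x a = middleSet x a₀ →
      (∀ b ∈ middleSet x a, (a.IsPos ↔ ¬ b.IsPos) → a.coord x < b.coord x) ∧
      ∀ C', IsRunList x (insert a (middleSet x a)) C' → IsSignedPartition (C' ++ D) ∧
        (symList C' D).Pairwise fun I J =>
          ∀ c ∈ I.pts, ∀ d ∈ J.pts, Comparable c d → c.val x < d.val x := by
    intro a ha hmS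
    obtain ⟨hl, hr⟩ := abs_lt.1 ha.1
    have hle : ∀ b ∈ middleSet x a, |a.coord x| ≤ b.coord x := by
      rintro b ⟨h1, h2, h3, -⟩
      simpa [abs_of_pos h3] using (ha.2 b h1 h2).1
    refine ⟨fun b hb hs => lt_of_le_of_ne ((le_abs_self _).trans (hle b hb))
      (hx.coord_ne_of_opp hb.2.1 hs), fun C' hC' => ⟨?_, ?_⟩⟩
    · refine isSignedPartition_of_mem_iff (U := insert a {b | b ≠ a ∧ b ≠ -a ∧ 0 < b.coord x})
        ?_ ?_ ?_ ?_
      · intro B hB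
        rcases List.mem_append.1 hB with hB | hB
        · exact hC'.signed B hB
        · exact hD.signed B hB
      · refine List.pairwise_append.2 ⟨hC'.disjoint, hD.disjoint, fun B hB B' hB' => ?_⟩
        refine Set.disjoint_left.2 fun b hb hb' => ?_
        have h1 : 1 / 2 < b.coord x := (hD.mem_iff b).1 ⟨B', hB', hb'⟩
        rcases Set.mem_insert_iff.1 ((hC'.mem_iff b).1 ⟨B, hB, hb⟩) with rfl | h2
        · linarith
        · linarith [h2.2.2.2]
      · intro b
        have h1 := hC'.mem_iff b
        have h2 := hD.mem_iff b
        simp only [List.mem_append, or_and_right, exists_or, h1, h2]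
        simp only [Set.mem_insert_iff, middleSet, hT, Set.mem_ofPred_eq]
        constructor
        · rintro ((h | h) | h)
          · exact Or.inl h
          · exact Or.inr ⟨h.1, h.2.1, h.2.2.1⟩
          · refine Or.inr ⟨?_, ?_, by linarith⟩
            · rintro rfl; linarith
            · rintro rfl; rw [Elt.coord_neg] at h; linarith
        · rintro (h | h)
          · exact Or.inl (Or.inl h)
          · rcases lt_or_gt_of_ne (hx.coord_ne b).1 with h' | h'
            · exact Or.inl (Or.inr ⟨h.1, h.2.1, h.2.2, h'⟩)
            · exact Or.inr h'
      · intro b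
        have hna : -a ≠ a := fun h => by
          have := a.isPos_neg
          rw [h] at this
          tauto
        simp only [Set.mem_insert_iff, Set.mem_ofPred_eq, neg_eq_iff_eq_neg,
          Elt.coord_neg]
        by_cases h1 : b = a
        · subst h1
          simp [hna.symm]
        by_cases h2 : b = -a
        · subst h2
          simp [hna]
        have h2' : -b ≠ a := fun h => h2 (by rw [← h, neg_neg])
        rcases lt_or_gt_of_ne (ha.2 b h1 h2).2 with h3 | h3 <;> simp [h1, h2, h2', h3, h3.not_gt]
    · refine pairwise_symList_of_isRunList hC' hD ?_ (fun a ha => ha) ?_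
      · refine Set.forall_mem_insert.2 ⟨⟨hl, hr⟩, fun b hb => ⟨?_, hb.2.2.2⟩⟩
        linarith [hb.2.2.1]
      · have key : ∀ b ∈ middleSet x a, a ≠ b → (a.IsPos ↔ b.IsPos) →
            0 < a.coord x + b.coord x := fun b hb hne hs => by
          refine lt_of_le_of_ne ?_ (hx.coord_add_ne_zero hne hs).symm
          linarith [neg_abs_le (a.coord x), hle b hb]
        rintro b (rfl | hb) c (rfl | hc) hne hs
        · exact absurd rfl hne
        · exact key c hc hne hs
        · rw [add_comm]
          exact key b hb hne.symm hs.symm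
        · exact add_pos hb.2.2.1 hc.2.2.1
  rcases C with _ | ⟨B, C⟩
  · -- The central element is alone, and takes the sign of the first block above `1/2`.
    rcases D with _ | ⟨B₂, D⟩
    · exfalso
      have hall : ∀ b, b = a₀ ∨ b = -a₀ := by
        intro b
        by_contra! hb
        obtain ⟨-, hb0⟩ := ha₀.2 b hb.1 hb.2
        have key : ∀ c : Elt n, c ≠ a₀ → c ≠ -a₀ → ¬ 0 < c.coord x := by
          intro c h1 h2 h3
          rcases lt_or_gt_of_ne (hx.coord_ne c).1 with h | h
          · simpa using (hC.mem_iff c).2 ⟨h1, h2, h3, h⟩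
          · simpa using (hD.mem_iff c).2 h
        have h1 := key b hb.1 hb.2
        have h2 := key (-b) (fun h => hb.2 (by rw [← h, neg_neg])) (fun h => hb.1 (neg_injective h))
        rw [Elt.coord_neg] at h2
        exact hb0 (by linarith)
      obtain ⟨i, hi⟩ : ∃ i : Fin n, ∀ j : Fin n, j = i := by
        rcases a₀ with i | i
        · exact ⟨i, fun j => by simpa using hall (.pos j)⟩
        · exact ⟨i, fun j => by simpa using hall (.pos j)⟩
      have : Subsingleton (Fin n) := ⟨fun j k => (hi j).trans (hi k).symm⟩
      have h1 := Fin.subsingleton_iff_le_one.1 this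
      have h2 := i.isLt
      omega
    obtain ⟨e, he⟩ := (hD.signed B₂ (by simp)).1
    obtain ⟨a, ha, hm, hs⟩ := ha₀.exists_isPos_iff e.IsPos
    obtain ⟨hlt, hfin⟩ := hfacts a ha hm
    rw [← hm] at hC
    obtain ⟨hp, hpw⟩ := hfin _ (hC.cons_singleton (a := a) (fun h => h.1 rfl) (by simp) hlt)
    refine ⟨[{a}], B₂ :: D, ⟨hp, .singleton _, hD.chain, Or.inr (Or.inr
      ⟨{a}, B₂, D, rfl, rfl, Set.ncard_singleton a, ?_⟩)⟩, hpw⟩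
    rcases (hD.signed B₂ (by simp)).2 with h | h
    · exact Or.inl ⟨by rintro _ rfl; exact hs.2 (h e he), h⟩
    · exact Or.inr ⟨by rintro _ rfl h'; exact h e he (hs.1 h'), h⟩
  · -- The central element joins the first run, taking its sign.
    obtain ⟨e, he⟩ := (hC.signed B (by simp)).1
    obtain ⟨a, ha, hm, hs⟩ := ha₀.exists_isPos_iff e.IsPos
    obtain ⟨hlt, hfin⟩ := hfacts a ha hm
    rw [← hm] at hC
    have hC' := hC.insert_head (a := a) (fun h => h.1 rfl) he hs hlt
    obtain ⟨hp, hpw⟩ := hfin _ hC'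
    refine ⟨_, D, ⟨hp, hC'.chain, hD.chain, Or.inr (Or.inl ⟨_, C, rfl, ?_⟩)⟩, hpw⟩
    have hea : e ∈ middleSet x a := (hC.mem_iff e).1 ⟨B, by simp, he⟩
    exact (Set.one_lt_ncard (Set.toFinite _)).2
      ⟨a, Set.mem_insert _ _, e, Set.mem_insert_of_mem _ he, hea.1.symm⟩

/-- Every region is the cell of a point realizing admissible lists. -/
theorem exists_realizes_of_mem_regions (hn : n ≠ 1) {R : Set (Fin n → ℝ)}
    (hR : R ∈ regions (arrangement n)) :
    ∃ x C D, IsAdmissible C D ∧ Realizes x C D ∧ R = cell x := by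
  obtain ⟨y, hy, rfl⟩ := mem_regions_iff.1 hR
  obtain ⟨C, D, hCD, hpw⟩ := exists_admissible_pairwise hn hy
  obtain ⟨x, hx⟩ := hCD.1.exists_realizes
  exact ⟨x, C, D, hCD, hx, hx.cell_eq hCD.1 hy hpw⟩

end BoxedThreshold

open BoxedThreshold

theorem proposition3p8 (n : ℕ) (hn : n ≠ 1) :
    (∀ R ∈ BoxedThreshold.regions (BoxedThreshold.arrangement n),
      (BoxedThreshold.regionOrder R).IsTotalOrder ∧
      (BoxedThreshold.IsForm1 (BoxedThreshold.regionOrder R) ∨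
       BoxedThreshold.IsForm2 (BoxedThreshold.regionOrder R) ∨
       BoxedThreshold.IsForm3 (BoxedThreshold.regionOrder R))) ∧
    Set.BijOn BoxedThreshold.regionOrder
      (BoxedThreshold.regions (BoxedThreshold.arrangement n))
      {O : BoxedThreshold.BlockOrder n | O.IsTotalOrder ∧
        (BoxedThreshold.IsForm1 O ∨ BoxedThreshold.IsForm2 O ∨ BoxedThreshold.IsForm3 O)} := by
  have hmaps : ∀ R ∈ regions (arrangement n), (regionOrder R).IsTotalOrder ∧
      (IsForm1 (regionOrder R) ∨ IsForm2 (regionOrder R) ∨ IsForm3 (regionOrder R)) := by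
    intro R hR
    obtain ⟨x, C, D, hCD, hx, rfl⟩ := exists_realizes_of_mem_regions hn hR
    have hl := hx.isLayered hCD
    refine ⟨?_, isForm_iff.2 ⟨C, D, hCD, hx.regionOrder_cell hCD⟩⟩
    rw [hl.regionOrder_cell]
    exact levelOrder_isTotalOrder hl.generic
  refine ⟨hmaps, hmaps, fun R hR R' hR' h => ?_, fun O ⟨_, hO⟩ => ?_⟩
  · obtain ⟨x, C, D, hCD, hx, rfl⟩ := exists_realizes_of_mem_regions hn hR
    obtain ⟨x', C', D', hCD', hx', rfl⟩ := exists_realizes_of_mem_regions hn hR'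
    have hl := hx.isLayered hCD
    rw [hl.regionOrder_cell, (hx'.isLayered hCD').regionOrder_cell] at h
    exact cell_eq_of_levelOrder_eq hl.generic h
  · obtain ⟨C, D, hCD, rfl⟩ := isForm_iff.1 hO
    obtain ⟨x, hx⟩ := hCD.1.exists_realizes
    exact ⟨cell x, mem_regions_iff.2 ⟨x, (hx.isLayered hCD).generic, rfl⟩,
      hx.regionOrder_cell hCD⟩
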